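/- Let $d\ge 1$, let $\Omega\subseteq\mathbb{R}^d$ be open and convex, let $q\in\mathbb{N}_{\ge 0}$, $\eta>0$, $c\ge 0$, and put $m_q=\binom{q+d}{d}$. Then there is a constant $C=C(d,\Omega,q,\eta,c)$ such that the following holds. Let $(X_N)_{N\in\mathbb{N}}$ be a quasi-uniform sequence in $\Omega$ with constant $c$: each $X_N=\{x_1,\dots,x_N\}\subset\Omega$ consists of $N$ distinct points, and for all $N\ge 2$ the fill distance $h_N=\sup_{x\in\Omega}\min_i\|x-x_i\|_2$ and the separation radius $q_N=\tfrac12\min_{i\ne j}\|x_i-x_j\|_2$ satisfy $h_N\le c\,q_N$ and $q_N\le c\,h_N$. Let $k:\Omega\times\Omega\to\mathbb{R}$ be a kernel and let $N\ge 2$. Let $\mathcal{T}$ be a binary cluster tree with root $X_N$ in which every non-leaf cluster $v$ is the disjoint union of its two nonempty sons, obtained by splitting $v$ at the median of the coordinates along a longest edge of its bounding box $B_v$ (the smallest axis-parallel box containing $v$): along that edge, the coordinates of the points of one son are all at least as large as those of the other, and the two sons have nearly the same number of points (the numbers differ by at most $2$). Each leaf cluster is nonempty and has at most $m_q$ points.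 Let $\boldsymbol{\Sigma}$ be a samplet basis of $\mathrm{span}\{\delta_{x_1},\dots,\delta_{x_N}\}$ constructed recursively on $\mathcal{T}$: a leaf $v$ has the scaling functions $\delta_x$, $x\in v$, and no samplets. For a non-leaf cluster $v$, let $\boldsymbol{\Phi}=[\varphi_1,\dots,\varphi_n]$ be the row of the scaling functions of its two sons, $\boldsymbol{M}=[(z^{\alpha},\varphi_i)]_{|\alpha|\le q,\,1\le i\le n}$ the moment matrix, where $(f,\sum_i\omega_i\delta_{x_i})=\sum_i\omega_i f(x_i)$, and $\boldsymbol{M}^T=\boldsymbol{Q}\boldsymbol{R}$ a QR decomposition; the first $m_q$ entries of $\boldsymbol{\Phi}\boldsymbol{Q}$ (all of them if $n\le m_q$) are the scaling functions of $v$ and the remaining ones are the samplets of $v$. The basis $\boldsymbol{\Sigma}$ consists of the scaling functions of the root together with the samplets of all clusters. Let $\boldsymbol{K}^{\boldsymbol{\Sigma}}=[(k,\sigma\otimes\sigma')]_{\sigma,\sigma'\in\boldsymbol{\Sigma}}$, where $(k,\sigma\otimes\sigma')=\sum_{i,i'}\omega_i\omega'_{i'}k(x_i,x_{i'})$ for $\sigma=\sum_i\omega_i\delta_{x_i}$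 and $\sigma'=\sum_i\omega'_i\delta_{x_i}$, and let $\boldsymbol{K}^{\boldsymbol{\Sigma}}_\eta$ be the compressed matrix in which every entry belonging to elements $\sigma,\sigma'$ of clusters $v,v'$ with $$\mathrm{dist}(B_v,B_{v'})\ge\eta\max\{\mathrm{diam}(B_v),\mathrm{diam}(B_{v'})\}$$ is set to zero. Then at most $C\,N\log N$ entries of $\boldsymbol{K}^{\boldsymbol{\Sigma}}$ are not set to zero by this rule, and $\boldsymbol{K}^{\boldsymbol{\Sigma}}_\eta$ has at most $C\,N\log N$ nonzero entries. -/

import Mathlib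

open scoped NNReal ENNReal

noncomputable section

/-- The separation radius `q_X = (1/2) min_{i ≠ j} ‖x_i - x_j‖` of finitely many points. -/
def sepRadius {d N : ℕ} (X : Fin N → EuclideanSpace ℝ (Fin d)) : ℝ≥0∞ :=
  (⨅ (i : Fin N) (j : Fin N) (_ : i ≠ j), edist (X i) (X j)) / 2

/-- The fill distance `h_{X,Ω} = sup_{x ∈ Ω} min_i ‖x - x_i‖`; it may be infinite. -/
def fillDistance {d N : ℕ} (Ω : Set (EuclideanSpace ℝ (Fin d)))
    (X : Fin N → EuclideanSpace ℝ (Fin d)) : ℝ≥0∞ :=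
  ⨆ x ∈ Ω, ⨅ i : Fin N, edist x (X i)

/-- A sequence `(X_N)` of sets of `N` distinct points of `Ω` is quasi-uniform with constant `c`
if `q_{X_N}` and `h_{X_N,Ω}` are comparable, with constant `c`, for all `N ≥ 2`
(a single point has no separation radius). -/
structure IsQuasiUniform {d : ℕ} (Ω : Set (EuclideanSpace ℝ (Fin d))) (c : ℝ≥0)
    (X : (N : ℕ) → Fin N → EuclideanSpace ℝ (Fin d)) : Prop where
  mem : ∀ N i, X N i ∈ Ω
  injective : ∀ N, Function.Injective (X N)
  fill_le : ∀ N, 2 ≤ N → fillDistance Ω (X N) ≤ c * sepRadius (X N)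
  sep_le : ∀ N, 2 ≤ N → sepRadius (X N) ≤ c * fillDistance Ω (X N)

/-! ### Clusters and bounding boxes

A cluster is a nonempty set of points of `X`, given by the set of their indices. -/

/-- Smallest `i`-th coordinate of the points of a (nonempty) cluster. -/
def boxLower {d N : ℕ} (X : Fin N → EuclideanSpace ℝ (Fin d)) (v : Finset (Fin N))
    (i : Fin d) : ℝ :=
  sInf ((fun p => X p i) '' (v : Set (Fin N)))

/-- Largest `i`-th coordinate of the points of a (nonempty) cluster. -/
def boxUpper {d N : ℕ} (X : Fin N → EuclideanSpace ℝ (Fin d)) (v : Finset (Fin N))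
    (i : Fin d) : ℝ :=
  sSup ((fun p => X p i) '' (v : Set (Fin N)))

/-- The bounding box `B_v`: the smallest axis-parallel box containing the cluster. -/
def boundingBox {d N : ℕ} (X : Fin N → EuclideanSpace ℝ (Fin d)) (v : Finset (Fin N)) :
    Set (EuclideanSpace ℝ (Fin d)) :=
  {y | ∀ i, boxLower X v i ≤ y i ∧ y i ≤ boxUpper X v i}

/-- The length of the edge of `B_v` along dimension `i`. -/
def edgeLength {d N : ℕ} (X : Fin N → EuclideanSpace ℝ (Fin d)) (v : Finset (Fin N))
    (i : Fin d) : ℝ :=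
  boxUpper X v i - boxLower X v i

/-- The distance between two (nonempty) sets. -/
def setDist {d : ℕ} (A B : Set (EuclideanSpace ℝ (Fin d))) : ℝ :=
  sInf (Set.image2 dist A B)

/-- The admissibility condition `dist(B_v, B_w) ≥ η max {diam B_v, diam B_w}`. -/
def Admissible {d N : ℕ} (X : Fin N → EuclideanSpace ℝ (Fin d)) (η : ℝ)
    (v w : Finset (Fin N)) : Prop :=
  η * max (Metric.diam (boundingBox X v)) (Metric.diam (boundingBox X w)) ≤
    setDist (boundingBox X v) (boundingBox X w)

/-! ### Cluster trees -/

/-- Binary trees whose nodes carry clusters. -/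
inductive ClusterTree (N : ℕ) : Type
  | leaf (v : Finset (Fin N)) : ClusterTree N
  | node (v : Finset (Fin N)) (l r : ClusterTree N) : ClusterTree N

/-- The cluster at the root. -/
def ClusterTree.cluster {N : ℕ} : ClusterTree N → Finset (Fin N)
  | .leaf v => v
  | .node v _ _ => v

/-- `v` is split into `v₁` and `v₂` at the median of the coordinates along a longest edge of its
bounding box. Points on the median plane may go to either side, and the sizes of the two parts are
equal up to the rounding of the median rule (`⌊n/2⌋ + 1` against `⌈n/2⌉ - 1` points at worst). -/
structure IsMedianSplit {d N : ℕ} (X : Fin N → EuclideanSpace ℝ (Fin d))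
    (v v₁ v₂ : Finset (Fin N)) : Prop where
  union : v₁ ∪ v₂ = v
  disjoint : Disjoint v₁ v₂
  nonempty₁ : v₁.Nonempty
  nonempty₂ : v₂.Nonempty
  cut : ∃ ℓ : Fin d, (∀ i, edgeLength X v i ≤ edgeLength X v ℓ) ∧
    ∀ p ∈ v₁, ∀ p' ∈ v₂, X p' ℓ ≤ X p ℓ
  card₁ : v₁.card ≤ v₂.card + 2
  card₂ : v₂.card ≤ v₁.card + 2

/-- Every inner cluster is split at the median along a longest edge, and every leaf cluster has at
least one and at most `m` points. -/
def ClusterTree.IsBisection {d N : ℕ} (X : Fin N → EuclideanSpace ℝ (Fin d)) (m : ℕ) :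
    ClusterTree N → Prop
  | .leaf v => v.Nonempty ∧ v.card ≤ m
  | .node v l r =>
      IsMedianSplit X v l.cluster r.cluster ∧ l.IsBisection X m ∧ r.IsBisection X m

/-- A cluster tree for `X` itself: the root cluster contains all the points. -/
def IsBisectionTreeFor {d N : ℕ} (X : Fin N → EuclideanSpace ℝ (Fin d)) (m : ℕ)
    (t : ClusterTree N) : Prop :=
  t.cluster = Finset.univ ∧ t.IsBisection X m

/-! ### The samplet basis

An element `∑ ω_p δ_{x_p}` of `span {δ_{x_1}, …, δ_{x_N}}` is given by its coefficients `ω`. -/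

/-- The dimension `m_q` of the space of polynomials of total degree at most `q`. -/
def polyDim (d q : ℕ) : ℕ := (q + d).choose d

/-- The multi-indices `α` with `|α| ≤ q`. -/
def MultiIndex (d q : ℕ) : Type := {α : Fin d → ℕ // ∑ i, α i ≤ q}

/-- The moment `(z^α, φ)_Ω` of `φ = ∑ φ_p δ_{x_p}`. -/
def moment {d N : ℕ} (X : Fin N → EuclideanSpace ℝ (Fin d)) (α : Fin d → ℕ)
    (φ : Fin N → ℝ) : ℝ :=
  ∑ p, φ p * ∏ i, X p i ^ α i

/-- The moment matrix of a row `Φ` of functionals, for an ordering `e` of the multi-indices. -/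
def momentMatrix {d N q : ℕ} (X : Fin N → EuclideanSpace ℝ (Fin d))
    (e : Fin (polyDim d q) ≃ MultiIndex d q) (Φ : List (Fin N → ℝ)) :
    Matrix (Fin (polyDim d q)) (Fin Φ.length) ℝ :=
  Matrix.of fun a i => moment X (e a).1 (Φ.get i)

/-- `Q` is the orthogonal factor of a QR decomposition `Mᵀ = Q R` of the transposed moment matrix
of `Φ`; `R` is upper triangular, and the rows of `M` may be ordered arbitrarily. -/
def IsQRFactor {d N : ℕ} (X : Fin N → EuclideanSpace ℝ (Fin d)) (q : ℕ)
    (Φ : List (Fin N → ℝ)) (Q : Matrix (Fin Φ.length) (Fin Φ.length) ℝ) : Prop :=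
  Q ∈ Matrix.orthogonalGroup (Fin Φ.length) ℝ ∧
    ∃ (e : Fin (polyDim d q) ≃ MultiIndex d q)
      (R : Matrix (Fin Φ.length) (Fin (polyDim d q)) ℝ),
      (∀ i j, j.val < i.val → R i j = 0) ∧ (momentMatrix X e Φ).transpose = Q * R

/-- The row `Φ Q`. -/
def transformRow {N : ℕ} (Φ : List (Fin N → ℝ))
    (Q : Matrix (Fin Φ.length) (Fin Φ.length) ℝ) : List (Fin N → ℝ) :=
  List.ofFn fun k => ∑ i, Q i k • Φ.get i

/-- `IsSampletConstruction X q t Φ S`: the recursive construction on the tree `t` can produce the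
scaling functions `Φ` of the root cluster of `t` and the list `S` of all samplets of the clusters
of `t`, each samplet being listed together with its cluster. A leaf has the scaling functions
`δ_x` and no samplets. At an inner cluster the scaling functions of the two sons are multiplied by
the orthogonal factor `Q`; the first `m_q` results are the scaling functions of the cluster, the
remaining ones are its samplets. -/
inductive IsSampletConstruction {d N : ℕ} (X : Fin N → EuclideanSpace ℝ (Fin d)) (q : ℕ) :
    ClusterTree N → List (Fin N → ℝ) → List (Finset (Fin N) × (Fin N → ℝ)) → Prop
  | leaf (v : Finset (Fin N)) :
      IsSampletConstruction X q (.leaf v)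
        (v.toList.map fun p => (Pi.single p 1 : Fin N → ℝ)) []
  | node (v : Finset (Fin N)) (l r : ClusterTree N) (Φl Φr : List (Fin N → ℝ))
      (Sl Sr : List (Finset (Fin N) × (Fin N → ℝ)))
      (Q : Matrix (Fin (Φl ++ Φr).length) (Fin (Φl ++ Φr).length) ℝ)
      (hl : IsSampletConstruction X q l Φl Sl)
      (hr : IsSampletConstruction X q r Φr Sr)
      (hQ : IsQRFactor X q (Φl ++ Φr) Q) :
      IsSampletConstruction X q (.node v l r)
        ((transformRow (Φl ++ Φr) Q).take (polyDim d q))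
        (((transformRow (Φl ++ Φr) Q).drop (polyDim d q)).map (fun σ => (v, σ)) ++ (Sl ++ Sr))

/-- `B` is a samplet basis on the tree `t`: the scaling functions of the root cluster together with
the samplets of all clusters, each with the cluster it belongs to. -/
def IsSampletBasis {d N : ℕ} (X : Fin N → EuclideanSpace ℝ (Fin d)) (q : ℕ)
    (t : ClusterTree N) (B : List (Finset (Fin N) × (Fin N → ℝ))) : Prop :=
  ∃ Φ S, IsSampletConstruction X q t Φ S ∧ B = Φ.map (fun φ => (t.cluster, φ)) ++ S

/-! ### The compressed kernel matrix -/

/-- The kernel matrix in samplet representation, with entries `(k, σ_a ⊗ σ_b)_{Ω × Ω}`. -/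
def sampletMatrix {d N : ℕ} (X : Fin N → EuclideanSpace ℝ (Fin d))
    (k : EuclideanSpace ℝ (Fin d) → EuclideanSpace ℝ (Fin d) → ℝ)
    (B : List (Finset (Fin N) × (Fin N → ℝ))) : Matrix (Fin B.length) (Fin B.length) ℝ :=
  Matrix.of fun a b => ∑ p, ∑ p', (B.get a).2 p * (B.get b).2 p' * k (X p) (X p')

open Classical in
/-- The compressed matrix: all entries whose clusters are admissible are set to zero. -/
def compressedMatrix {d N : ℕ} (X : Fin N → EuclideanSpace ℝ (Fin d))
    (k : EuclideanSpace ℝ (Fin d) → EuclideanSpace ℝ (Fin d) → ℝ) (η : ℝ)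
    (B : List (Finset (Fin N) × (Fin N → ℝ))) : Matrix (Fin B.length) (Fin B.length) ℝ :=
  Matrix.of fun a b =>
    if Admissible X η (B.get a).1 (B.get b).1 then 0 else sampletMatrix X k B a b

end

open scoped NNReal ENNReal

/-! ### Bounding boxes and central points. -/

section Boxes

variable {d N : ℕ} {X : Fin N → EuclideanSpace ℝ (Fin d)} {u v : Finset (Fin N)}

/-! Each cluster owns at most `2 * polyDim d q` basis elements, the depth of the tree is `O(log N)`,
and admissibility is symmetric. So it suffices that a cluster is inadmissible with boundedly many
clusters of each depth `j` up to its own (`card_close_clusters_le`). Those clusters are disjoint and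
hold about `N / 2 ^ j` points each. If every box satisfies `maxEdge ^ d ≤ (T * h) ^ d * card`, they
all lie in a ball in which the separation of the points leaves room for boundedly many of them.

This size estimate (`exists_maxEdge_pow_le`) is the heart of the matter. Below the scale `T * h` it
is trivial. Above it, a volume argument gives it for clusters that contain every point inside their
box and whose box edges are comparable (`maxEdge_pow_le_of_isShapeRegular`). It remains to see that
median cuts in a convex set create no thin boxes.

A single cut cannot: a son with a quarter of the points is no thin slab, since its contractions
towards a distant point, at many different scales, would be disjoint and overfill the parent
(`maxEdge_div_le_edgeLength`). But cuts in other directions may also shorten an edge. Therefore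
`IsControlled` remembers, for each set `S` of directions, a cluster `u` from which `v` arises by
cuts outside `S`. By convexity a contracted copy of `u` fits into `v` up to the fill distance, so
the edges of `v` in `S` cannot all be short compared with the others
(`IsControlled.exists_le_mul_edgeLength`). Applying this to at most `d` sets `S` makes all edges
comparable. -/

theorem boxLower_le {p : Fin N} (hp : p ∈ v) (i : Fin d) : boxLower X v i ≤ X p i :=
  csInf_le (v.finite_toSet.image _).bddBelow ⟨p, hp, rfl⟩

theorem le_boxUpper {p : Fin N} (hp : p ∈ v) (i : Fin d) : X p i ≤ boxUpper X v i :=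
  le_csSup (v.finite_toSet.image _).bddAbove ⟨p, hp, rfl⟩

theorem exists_eq_boxLower (hv : v.Nonempty) (i : Fin d) : ∃ p ∈ v, X p i = boxLower X v i := by
  obtain ⟨p, hp, h⟩ := ((show (v : Set (Fin N)).Nonempty from hv).image
    fun p => X p i).csInf_mem (v.finite_toSet.image _)
  exact ⟨p, hp, h⟩

theorem exists_eq_boxUpper (hv : v.Nonempty) (i : Fin d) : ∃ p ∈ v, X p i = boxUpper X v i := by
  obtain ⟨p, hp, h⟩ := ((show (v : Set (Fin N)).Nonempty from hv).image
    fun p => X p i).csSup_mem (v.finite_toSet.image _)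
  exact ⟨p, hp, h⟩

theorem boxLower_anti (hv : v.Nonempty) (h : v ⊆ u) (i : Fin d) :
    boxLower X u i ≤ boxLower X v i := by
  obtain ⟨p, hp, hpi⟩ := exists_eq_boxLower (X := X) hv i
  exact hpi ▸ boxLower_le (h hp) i

theorem boxUpper_mono (hv : v.Nonempty) (h : v ⊆ u) (i : Fin d) :
    boxUpper X v i ≤ boxUpper X u i := by
  obtain ⟨p, hp, hpi⟩ := exists_eq_boxUpper (X := X) hv i
  exact hpi ▸ le_boxUpper (h hp) i

theorem edgeLength_nonneg (hv : v.Nonempty) (i : Fin d) : 0 ≤ edgeLength X v i := by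
  obtain ⟨p, hp⟩ := hv
  have h₁ := boxLower_le (X := X) hp i
  have h₂ := le_boxUpper (X := X) hp i
  unfold edgeLength
  linarith

theorem edgeLength_mono (hv : v.Nonempty) (h : v ⊆ u) (i : Fin d) :
    edgeLength X v i ≤ edgeLength X u i :=
  sub_le_sub (boxUpper_mono hv h i) (boxLower_anti hv h i)

theorem sub_le_edgeLength {p p' : Fin N} (hp : p ∈ v) (hp' : p' ∈ v) (i : Fin d) :
    X p i - X p' i ≤ edgeLength X v i :=
  sub_le_sub (le_boxUpper hp i) (boxLower_le hp' i)

theorem mem_boundingBox {p : Fin N} (hp : p ∈ v) : X p ∈ boundingBox X v :=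
  fun i => ⟨boxLower_le hp i, le_boxUpper hp i⟩

/-- The length of a longest edge of the bounding box. -/
noncomputable def maxEdge (X : Fin N → EuclideanSpace ℝ (Fin d)) (v : Finset (Fin N)) : ℝ :=
  ⨆ i, edgeLength X v i

theorem edgeLength_le_maxEdge (i : Fin d) : edgeLength X v i ≤ maxEdge X v :=
  le_ciSup (Set.finite_range _).bddAbove i

theorem maxEdge_nonneg (hv : v.Nonempty) : 0 ≤ maxEdge X v :=
  Real.iSup_nonneg fun i => edgeLength_nonneg hv i

theorem maxEdge_mono (hd : 0 < d) (hv : v.Nonempty) (h : v ⊆ u) : maxEdge X v ≤ maxEdge X u := by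
  have : Nonempty (Fin d) := ⟨⟨0, hd⟩⟩
  exact ciSup_le fun i => (edgeLength_mono hv h i).trans (edgeLength_le_maxEdge i)

theorem maxEdge_eq {ℓ : Fin d} (h : ∀ i, edgeLength X v i ≤ edgeLength X v ℓ) :
    maxEdge X v = edgeLength X v ℓ := by
  have : Nonempty (Fin d) := ⟨ℓ⟩
  exact le_antisymm (ciSup_le h) (edgeLength_le_maxEdge ℓ)

theorem abs_sub_apply_le_dist (x y : EuclideanSpace ℝ (Fin d)) (i : Fin d) :
    |x i - y i| ≤ dist x y := by
  rw [dist_eq_norm]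
  exact PiLp.norm_apply_le (x - y) i

theorem dist_le_of_forall_abs_sub_le {x y : EuclideanSpace ℝ (Fin d)} {r : ℝ} (hr : 0 ≤ r)
    (h : ∀ i, |x i - y i| ≤ r) : dist x y ≤ d * r := by
  rw [EuclideanSpace.dist_eq, Real.sqrt_le_left (by positivity)]
  calc ∑ i, dist (x i) (y i) ^ 2 ≤ ∑ _i : Fin d, r ^ 2 :=
        Finset.sum_le_sum fun i _ => pow_le_pow_left₀ dist_nonneg (h i) 2
    _ = d * r ^ 2 := by simp
    _ ≤ (d * r) ^ 2 := by
        rw [mul_pow]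
        gcongr
        exact_mod_cast Nat.le_self_pow two_ne_zero d

theorem dist_le_of_mem_boundingBox (hv : v.Nonempty) {x y : EuclideanSpace ℝ (Fin d)}
    (hx : x ∈ boundingBox X v) (hy : y ∈ boundingBox X v) : dist x y ≤ d * maxEdge X v := by
  refine dist_le_of_forall_abs_sub_le (maxEdge_nonneg hv) fun i => ?_
  have h := edgeLength_le_maxEdge (X := X) (v := v) i
  unfold edgeLength at h
  rw [abs_le]
  constructor <;> linarith [hx i, hy i, (hx i).1, (hx i).2, (hy i).1, (hy i).2]

theorem diam_boundingBox_le (hv : v.Nonempty) :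
    Metric.diam (boundingBox X v) ≤ d * maxEdge X v :=
  Metric.diam_le_of_forall_dist_le (mul_nonneg d.cast_nonneg (maxEdge_nonneg hv))
    fun _ hx _ hy => dist_le_of_mem_boundingBox hv hx hy

/-- The mean of extremal points of a cluster stays away from all faces of the bounding box. -/
theorem exists_central_point (hd : 0 < d) {Ω : Set (EuclideanSpace ℝ (Fin d))} (hΩ : Convex ℝ Ω)
    (hX : ∀ p, X p ∈ Ω) (hv : v.Nonempty) :
    ∃ z ∈ Ω, ∀ i, boxLower X v i + edgeLength X v i / (2 * d) ≤ z i ∧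
      z i ≤ boxUpper X v i - edgeLength X v i / (2 * d) := by
  have hd' : (0 : ℝ) < d := by exact_mod_cast hd
  choose lo hlo hlo' using fun i => exists_eq_boxLower (X := X) hv i
  choose up hup hup' using fun i => exists_eq_boxUpper (X := X) hv i
  let m : Fin d → EuclideanSpace ℝ (Fin d) :=
    fun i => (1 / 2 : ℝ) • X (lo i) + (1 / 2 : ℝ) • X (up i)
  have hm : ∀ i k, m i k = (X (lo i) k + X (up i) k) / 2 := fun i k => by
    simp [m]; ring
  have hzi : ∀ k, (∑ i, (1 / d : ℝ) • m i) k = ∑ i, (1 / d : ℝ) * m i k := fun k => by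
    simp [Finset.sum_apply]
  refine ⟨∑ i, (1 / d : ℝ) • m i, hΩ.sum_mem (fun _ _ => by positivity) ?_ fun i _ => ?_,
    fun k => ?_⟩
  · simp [hd'.ne']
  · exact hΩ (hX _) (hX _) (by norm_num) (by norm_num) (by norm_num)
  -- Among the `d` averaged midpoints, the one for direction `k` is centred in that direction; its
  -- weight `1 / d` yields the margin `1 / (2 * d)`.
  · have key : ∀ i, boxLower X v k + (if i = k then edgeLength X v k / 2 else 0) ≤ m i k ∧
        m i k ≤ boxUpper X v k - (if i = k then edgeLength X v k / 2 else 0) := by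
      intro i
      rw [hm]
      split_ifs with h
      · subst h
        rw [hlo', hup']
        unfold edgeLength
        constructor <;> linarith
      · have h₁ := boxLower_le (X := X) (hlo i) k
        have h₂ := boxLower_le (X := X) (hup i) k
        have h₃ := le_boxUpper (X := X) (hlo i) k
        have h₄ := le_boxUpper (X := X) (hup i) k
        constructor <;> linarith
    rw [hzi, ← Finset.mul_sum]
    have h₁ := Finset.sum_le_sum fun i (_ : i ∈ Finset.univ) => (key i).1
    have h₂ := Finset.sum_le_sum fun i (_ : i ∈ Finset.univ) => (key i).2
    simp only [Finset.sum_add_distrib, Finset.sum_sub_distrib, Finset.sum_const,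
      Finset.card_univ, Fintype.card_fin, nsmul_eq_mul, Finset.sum_ite_eq', Finset.mem_univ,
      if_true] at h₁ h₂
    have e₁ : boxLower X v k + edgeLength X v k / (2 * d) =
        1 / d * (d * boxLower X v k + edgeLength X v k / 2) := by field_simp
    have e₂ : boxUpper X v k - edgeLength X v k / (2 * d) =
        1 / d * (d * boxUpper X v k - edgeLength X v k / 2) := by field_simp
    rw [e₁, e₂]
    exact ⟨by gcongr, by gcongr⟩

end Boxes

/-! ### Volume bounds for numbers of points. -/

section Packing

open MeasureTheory

variable {d N : ℕ} {X : Fin N → EuclideanSpace ℝ (Fin d)}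

/-- The balls of radius `s / 2` about the points are disjoint and lie in the ball of radius `R + s /
2`. -/
theorem card_le_of_separated {s R : ℝ} (hs : 0 < s) (hR : 0 ≤ R)
    (hsep : ∀ p p', p ≠ p' → s ≤ dist (X p) (X p')) (y : EuclideanSpace ℝ (Fin d))
    (F : Finset (Fin N)) (hF : ∀ p ∈ F, dist (X p) y ≤ R) :
    (F.card : ℝ) ≤ (2 * R / s + 1) ^ d := by
  have hμ : ∀ (x : EuclideanSpace ℝ (Fin d)) {r : ℝ}, 0 < r → volume (Metric.ball x r) =
      ENNReal.ofReal (r ^ d) * volume (Metric.ball (0 : EuclideanSpace ℝ (Fin d)) 1) := by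
    intro x r hr
    simpa using Measure.addHaar_ball_of_pos volume x hr
  have hdisj : (F : Set (Fin N)).PairwiseDisjoint fun p => Metric.ball (X p) (s / 2) := by
    intro p _ p' _ hpp
    exact Metric.ball_disjoint_ball (by linarith [hsep p p' hpp])
  have hsub : (⋃ p ∈ F, Metric.ball (X p) (s / 2)) ⊆ Metric.ball y (R + s / 2) := by
    refine Set.iUnion₂_subset fun p hp => Metric.ball_subset_ball' ?_
    linarith [hF p hp]
  have h := measure_mono (μ := volume) hsub
  rw [measure_biUnion_finset hdisj fun _ _ => measurableSet_ball,
    Finset.sum_congr rfl fun p _ => hμ (X p) (half_pos hs), hμ y (r := R + s / 2) (by positivity),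
    Finset.sum_const, nsmul_eq_mul, ← mul_assoc,
    ENNReal.mul_le_mul_iff_left (Metric.measure_ball_pos volume _ one_pos).ne'
      measure_ball_lt_top.ne, ← ENNReal.ofReal_natCast, ← ENNReal.ofReal_mul (by positivity),
    ENNReal.ofReal_le_ofReal_iff (by positivity)] at h
  have e : (2 * R / s + 1) ^ d = (R + s / 2) ^ d / (s / 2) ^ d := by
    rw [← div_pow]
    congr 1
    field_simp
  rw [e, le_div_iff₀ (by positivity)]
  exact h

/-- The ball of radius `ρ - h` is covered by balls of radius `h` about points that are still within
`ρ` of `y`. -/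
theorem le_card_of_fill {Ω : Set (EuclideanSpace ℝ (Fin d))} {h ρ : ℝ} (hh : 0 < h) (hρ : h < ρ)
    (hfill : ∀ y ∈ Ω, ∃ p, dist y (X p) ≤ h) (y : EuclideanSpace ℝ (Fin d))
    (hy : Metric.ball y ρ ⊆ Ω) (F : Finset (Fin N)) (hF : ∀ p, dist (X p) y < ρ → p ∈ F) :
    ((ρ - h) / h) ^ d ≤ F.card := by
  have hμ : ∀ (x : EuclideanSpace ℝ (Fin d)) {r : ℝ}, 0 < r → volume (Metric.ball x r) =
      ENNReal.ofReal (r ^ d) * volume (Metric.ball (0 : EuclideanSpace ℝ (Fin d)) 1) := by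
    intro x r hr
    simpa using Measure.addHaar_ball_of_pos volume x hr
  have hμ' : ∀ x : EuclideanSpace ℝ (Fin d), volume (Metric.closedBall x h) =
      ENNReal.ofReal (h ^ d) * volume (Metric.ball (0 : EuclideanSpace ℝ (Fin d)) 1) := by
    intro x
    simpa using Measure.addHaar_closedBall volume x hh.le
  have hsub : Metric.ball y (ρ - h) ⊆ ⋃ p ∈ F, Metric.closedBall (X p) h := by
    intro x hx
    rw [Metric.mem_ball] at hx
    obtain ⟨p, hp⟩ := hfill x (hy (Metric.mem_ball.2 (by linarith)))
    refine Set.mem_iUnion₂.2 ⟨p, hF p ?_, hp⟩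
    have := dist_triangle_left (X p) y x
    linarith
  have hle := (measure_mono (μ := volume) hsub).trans (measure_biUnion_finset_le _ _)
  rw [Finset.sum_congr rfl fun p _ => hμ' (X p), hμ y (r := ρ - h) (by linarith),
    Finset.sum_const, nsmul_eq_mul, ← mul_assoc,
    ENNReal.mul_le_mul_iff_left (Metric.measure_ball_pos volume _ one_pos).ne'
      measure_ball_lt_top.ne, ← ENNReal.ofReal_natCast, ← ENNReal.ofReal_mul (by positivity),
    ENNReal.ofReal_le_ofReal_iff (by positivity)] at hle
  rw [div_pow, div_le_iff₀ (by positivity)]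
  exact hle

end Packing

/-! ### A single cut leaves no thin slab. -/

section Shape

variable {d N : ℕ} {X : Fin N → EuclideanSpace ℝ (Fin d)} {u v w : Finset (Fin N)}

/-- The edges of the bounding box are comparable up to the factor `A`. -/
def IsShapeRegular (X : Fin N → EuclideanSpace ℝ (Fin d)) (A : ℝ) (v : Finset (Fin N)) : Prop :=
  ∀ i, maxEdge X v ≤ A * edgeLength X v i

/-- The part of `w` in the `j`-th direction sees a central point of the bounding box of `u`
from afar. -/
theorem exists_far_central_point (hd : 0 < d) {Ω : Set (EuclideanSpace ℝ (Fin d))}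
    (hΩ : Convex ℝ Ω) (hX : ∀ p, X p ∈ Ω) (hu : u.Nonempty) (j : Fin d) (a : ℝ) :
    ∃ z ∈ Ω, edgeLength X u j / 4 ≤ |z j - a| ∧ ∀ i,
      boxLower X u i + edgeLength X u i / (8 * d) ≤ z i ∧
        z i ≤ boxUpper X u i - edgeLength X u i / (8 * d) := by
  obtain ⟨p, hp, hpi⟩ := exists_central_point hd hΩ hX hu
  have hd' : (0 : ℝ) < d := by exact_mod_cast hd
  obtain ⟨b, hb, hbj⟩ : ∃ b ∈ u, edgeLength X u j / 2 ≤ X b j - a ∨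
      edgeLength X u j / 2 ≤ a - X b j := by
    obtain ⟨b, hb, hbj⟩ := exists_eq_boxLower (X := X) hu j
    obtain ⟨b', hb', hbj'⟩ := exists_eq_boxUpper (X := X) hu j
    rcases le_total (edgeLength X u j / 2) (a - X b j) with h | h
    · exact ⟨b, hb, Or.inr h⟩
    · refine ⟨b', hb', Or.inl ?_⟩
      unfold edgeLength at h ⊢
      linarith
  have hc : ∀ i, ((3 / 4 : ℝ) • X b + (1 / 4 : ℝ) • p) i = 3 / 4 * X b i + 1 / 4 * p i :=
    fun i => by simp
  -- The point `b` supplies the distance from `a`, the central point `p` the margin to the faces. In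
  -- the worst case `p` costs an eighth of the edge: `3 / 8 - 1 / 8 = 1 / 4`.
  refine ⟨(3 / 4 : ℝ) • X b + (1 / 4 : ℝ) • p,
    hΩ (hX b) hp (by norm_num) (by norm_num) (by norm_num), ?_, fun i => ?_⟩
  · rw [hc]
    have h₁ := hpi j
    have h₀ : 0 ≤ edgeLength X u j / (2 * d) :=
      div_nonneg (edgeLength_nonneg hu j) (by positivity)
    have h₂ := boxLower_le (X := X) hb j
    have h₃ := le_boxUpper (X := X) hb j
    have h₄ : edgeLength X u j = boxUpper X u j - boxLower X u j := rfl
    rcases hbj with h | h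
    · refine le_trans ?_ (le_abs_self _)
      linarith [h₁.1, h₁.2]
    · refine le_trans ?_ (neg_le_abs _)
      linarith [h₁.1, h₁.2]
  · rw [hc]
    have h₁ := hpi i
    have h₂ := boxLower_le (X := X) hb i
    have h₃ := le_boxUpper (X := X) hb i
    have e : edgeLength X u i / (8 * d) = 1 / 4 * (edgeLength X u i / (2 * d)) := by
      ring
    rw [e]
    constructor <;> linarith [h₁.1, h₁.2]

/-- A subcluster with a fixed share of the points has a fixed share of the extent. -/
theorem maxEdge_div_le_edgeLength (hd : 0 < d) {Ω : Set (EuclideanSpace ℝ (Fin d))}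
    (hΩ : Convex ℝ Ω) (hX : ∀ p, X p ∈ Ω) {h : ℝ} (hh : 0 < h)
    (hfill : ∀ y ∈ Ω, ∃ p, dist y (X p) ≤ h) {D : ℕ}
    (hD : ∀ (y : EuclideanSpace ℝ (Fin d)) (F : Finset (Fin N)),
      (∀ p ∈ F, dist (X p) y ≤ 4 * h) → F.card ≤ D)
    (hw : w.Nonempty) (hwu : w ⊆ u) (hcard : u.card ≤ 4 * w.card)
    (hint : ∀ p, (∀ i, boxLower X u i < X p i ∧ X p i < boxUpper X u i) → p ∈ u)
    {A : ℝ} (hA : 0 < A) (hreg : IsShapeRegular X A u) {j : Fin d}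
    (hj : edgeLength X u j = maxEdge X u)
    (hM : h * (8 * d * A * 16 ^ (4 * D + 1)) < maxEdge X u)
    (hM' : h * (128 * 16 ^ (4 * D + 1)) ≤ maxEdge X u) :
    maxEdge X u / (128 * 16 ^ (4 * D + 1)) ≤ edgeLength X w j := by
  by_contra! hlt
  set k := 4 * D + 1 with hk
  set M := maxEdge X u with hMdef
  have hd' : (0 : ℝ) < d := by exact_mod_cast hd
  have hu : u.Nonempty := hw.mono hwu
  set δ := M / (128 * 16 ^ k) with hδ
  have hhδ : h ≤ δ := by rw [hδ, le_div_iff₀ (by positivity)]; exact hM'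
  have hM0 : 0 < M := lt_of_lt_of_le (by positivity) hM'
  obtain ⟨z, hz, hza, hzi⟩ := exists_far_central_point hd hΩ hX hu j (boxLower X w j)
  set a := boxLower X w j with hadef
  -- Contraction scales: moving the slab `w` by the fraction `τ i` towards `z` puts it at distance
  -- between about `τ i * M / 4` and `τ i * M` from the plane at height `a`. The ratio 16 separates
  -- these ranges.
  let τ : ℕ → ℝ := fun i => (1 / 16) ^ (i + 1)
  have hτ0 : ∀ i, 0 < τ i := fun i => by positivity
  have hτ1 : ∀ i, τ i ≤ 1 / 16 := fun i => by
    have : (1 / 16 : ℝ) ^ i ≤ 1 := pow_le_one₀ (by norm_num) (by norm_num)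
    simp only [τ, pow_succ]
    linarith
  have hτk : ∀ i, i < k → 1 / 16 ^ k ≤ τ i := fun i hi => by
    rw [← one_div_pow]
    exact pow_le_pow_of_le_one (by norm_num) (by norm_num) hi
  have hτδ : ∀ i, i < k → 128 * δ ≤ τ i * M := fun i hi => by
    have e : 128 * δ = 1 / 16 ^ k * M := by rw [hδ]; field_simp
    rw [e]
    exact mul_le_mul_of_nonneg_right (hτk i hi) hM0.le
  have hτlt : ∀ i i', i < i' → 16 * τ i' ≤ τ i := fun i i' hi => by
    have : τ i' ≤ (1 / 16) ^ (i + 1 + 1) :=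
      pow_le_pow_of_le_one (by norm_num) (by norm_num) (by omega)
    have e : (1 / 16 : ℝ) ^ (i + 1 + 1) = τ i * (1 / 16) := pow_succ _ _
    linarith
  let y : ℕ → Fin N → EuclideanSpace ℝ (Fin d) := fun i x => (1 - τ i) • X x + τ i • z
  have hy : ∀ i x, y i x ∈ Ω := fun i x =>
    hΩ (hX x) hz (by linarith [hτ1 i]) (hτ0 i).le (by ring)
  have hyi : ∀ i x l, y i x l = X x l + τ i * (z l - X x l) := fun i x l => by
    simp [y]; ring
  choose π hπ using fun i x => hfill (y i x) (hy i x)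
  have hπi : ∀ i x l, |y i x l - X (π i x) l| ≤ h := fun i x l =>
    (abs_sub_apply_le_dist _ _ l).trans (hπ i x)
  -- The contraction gains a margin of `τ i` times that of `z`, which exceeds the rounding error
  -- `h`.
  have hπu : ∀ i x, i < k → x ∈ w → π i x ∈ u := by
    intro i x hi hx
    refine hint _ fun l => ?_
    have h₁ := boxLower_le (X := X) (hwu hx) l
    have h₂ := le_boxUpper (X := X) (hwu hx) l
    have h₃ := abs_le.1 (hπi i x l)
    rw [hyi] at h₃
    have h₄ : h < τ i * (edgeLength X u l / (8 * d)) := by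
      have h₅ : M / A ≤ edgeLength X u l := by
        rw [div_le_iff₀ hA, mul_comm]; exact hreg l
      calc h < 1 / 16 ^ k * (M / A / (8 * d)) := by
            rw [show 1 / 16 ^ k * (M / A / (8 * d)) = M / (8 * d * A * 16 ^ k) by field_simp,
              lt_div_iff₀ (by positivity)]
            exact hM
        _ ≤ τ i * (edgeLength X u l / (8 * d)) := by
            have := hτ0 i
            gcongr
            exact hτk i hi
    have h₆ := mul_le_mul_of_nonneg_left (hzi l).1 (hτ0 i).le
    have h₇ := mul_le_mul_of_nonneg_left (hzi l).2 (hτ0 i).le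
    have h₈ := mul_le_mul_of_nonneg_left h₁ (show 0 ≤ 1 - τ i by linarith [hτ1 i])
    have h₉ := mul_le_mul_of_nonneg_left h₂ (show 0 ≤ 1 - τ i by linarith [hτ1 i])
    constructor <;> nlinarith [h₃.1, h₃.2]
  have hxa : ∀ x ∈ w, 0 ≤ X x j - a ∧ X x j - a ≤ δ := fun x hx => by
    have h₁ := boxLower_le (X := X) hx j
    have h₂ := le_boxUpper (X := X) hx j
    unfold edgeLength at hlt
    constructor <;> linarith
  have hzM : |z j - a| ≤ M := by
    have ha : boxLower X u j ≤ a := boxLower_anti hw hwu j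
    have ha' : a ≤ boxUpper X u j := by
      have h₁ := edgeLength_nonneg (X := X) hw j
      have h₂ := boxUpper_mono (X := X) hw hwu j
      unfold edgeLength at h₁
      linarith
    have h₀ : 0 ≤ edgeLength X u j / (8 * d) :=
      div_nonneg (edgeLength_nonneg hu j) (by positivity)
    have h₁ := hzi j
    unfold edgeLength at hj h₀ h₁
    rw [abs_le]
    constructor <;> linarith [h₁.1, h₁.2]
  -- The error `2 * δ` is the slab width plus the rounding error `h ≤ δ`.
  have hfar : ∀ i x, i < k → x ∈ w →
      τ i * M / 4 - 2 * δ ≤ |X (π i x) j - a| ∧ |X (π i x) j - a| ≤ τ i * M + 2 * δ := by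
    intro i x hi hx
    have h₁ := hxa x hx
    have e : X (π i x) j - a = τ i * (z j - a) +
        ((1 - τ i) * (X x j - a) - (y i x j - X (π i x) j)) := by rw [hyi]; ring
    have h₂ : |(1 - τ i) * (X x j - a) - (y i x j - X (π i x) j)| ≤ 2 * δ := by
      refine (abs_sub _ _).trans ?_
      have h₃ : |(1 - τ i) * (X x j - a)| ≤ δ := by
        rw [abs_of_nonneg (mul_nonneg (by linarith [hτ1 i]) h₁.1)]
        nlinarith [hτ0 i]
      linarith [hπi i x j]
    have h₄ : |τ i * (z j - a)| = τ i * |z j - a| := by rw [abs_mul, abs_of_pos (hτ0 i)]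
    have h₅ := mul_le_mul_of_nonneg_left hzM (hτ0 i).le
    have h₆ := mul_le_mul_of_nonneg_left hza (hτ0 i).le
    rw [hj] at h₆
    rw [e]
    constructor
    · have := abs_sub_abs_le_abs_add (τ i * (z j - a))
        ((1 - τ i) * (X x j - a) - (y i x j - X (π i x) j))
      linarith
    · have := abs_add_le (τ i * (z j - a))
        ((1 - τ i) * (X x j - a) - (y i x j - X (π i x) j))
      linarith
  have hneq : ∀ i i' x x', i < i' → i' < k → x ∈ w → x' ∈ w → π i x ≠ π i' x' := by
    intro i i' x x' hii hi' hx hx' heq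
    have h₁ := (hfar i x (hii.trans hi') hx).1
    have h₂ := (hfar i' x' hi' hx').2
    rw [heq] at h₁
    have h₃ := hτδ i (hii.trans hi')
    have h₄ := mul_le_mul_of_nonneg_right (hτlt i i' hii) hM0.le
    have : 0 < δ := hh.trans_le hhδ
    linarith
  have hclose : ∀ i x x', π i x = π i x' → dist (X x) (X x') ≤ 4 * h := by
    intro i x x' heq
    have h₁ : dist (y i x) (y i x') ≤ 2 * h := by
      have h₂ := hπ i x
      have h₃ := hπ i x'
      rw [← heq] at h₃
      linarith [dist_triangle_right (y i x) (y i x') (X (π i x))]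
    have h₂ : dist (y i x) (y i x') = (1 - τ i) * dist (X x) (X x') := by
      rw [dist_add_right, dist_smul₀, Real.norm_of_nonneg (by linarith [hτ1 i])]
    rw [h₂] at h₁
    nlinarith [hτ1 i, dist_nonneg (x := X x) (y := X x')]
  -- All `k` copies of `w` are mapped into `u`. A fibre stays within one scale and has diameter at
  -- most `4 * h`, so it has at most `D` elements. Hence `k * w.card ≤ D * u.card ≤ 4 * D * w.card`,
  -- which contradicts `k = 4 * D + 1`.
  have hcount := Finset.card_le_mul_card_image_of_maps_to
    (s := (Finset.univ : Finset (Fin k)) ×ˢ w) (t := u) (f := fun a => π a.1 a.2)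
    (fun a ha => hπu _ _ a.1.2 (Finset.mem_product.1 ha).2) D (by
      intro b _
      rcases Finset.eq_empty_or_nonempty
        {a ∈ (Finset.univ : Finset (Fin k)) ×ˢ w | π a.1 a.2 = b} with he | ⟨a₀, ha₀⟩
      · simp [he]
      · rw [Finset.mem_filter, Finset.mem_product] at ha₀
        have hfst : ∀ a ∈ (Finset.univ : Finset (Fin k)) ×ˢ w, π a.1 a.2 = b → a.1 = a₀.1 := by
          intro a ha hab
          rw [Finset.mem_product] at ha
          rcases lt_trichotomy a.1 a₀.1 with hl | hl | hl
          · exact (hneq _ _ _ _ hl a₀.1.2 ha.2 ha₀.1.2 (hab.trans ha₀.2.symm)).elim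
          · exact hl
          · exact (hneq _ _ _ _ hl a.1.2 ha₀.1.2 ha.2 (ha₀.2.trans hab.symm)).elim
        rw [← Finset.card_image_of_injOn (f := Prod.snd)]
        · refine hD (X a₀.2) _ fun p hp => ?_
          obtain ⟨a, ha, rfl⟩ := Finset.mem_image.1 hp
          rw [Finset.mem_filter] at ha
          refine hclose a₀.1 _ _ ?_
          rw [ha₀.2, ← ha.2, hfst a ha.1 ha.2]
        · intro a ha a' ha' haa
          rw [Finset.mem_coe, Finset.mem_filter] at ha ha'
          exact Prod.ext ((hfst a ha.1 ha.2).trans (hfst a' ha'.1 ha'.2).symm) haa)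
  rw [Finset.card_product, Finset.card_univ, Fintype.card_fin] at hcount
  have h₁ := hcount.trans (Nat.mul_le_mul_left D hcard)
  have h₂ := hw.card_pos
  rw [hk] at h₁
  nlinarith

end Shape

/-! ### An invariant of bisection that forces shape regularity. -/

section Control

variable {d N : ℕ} {Ω : Set (EuclideanSpace ℝ (Fin d))} {X : Fin N → EuclideanSpace ℝ (Fin d)}
  {u v w : Finset (Fin N)} {h : ℝ} {D : ℕ}

/-- Points of a convex set with fill distance at most `h`, of which at most `D` lie in any ball of
radius `4 * h`. -/
structure IsNet (Ω : Set (EuclideanSpace ℝ (Fin d))) (X : Fin N → EuclideanSpace ℝ (Fin d))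
    (h : ℝ) (D : ℕ) : Prop where
  convex : Convex ℝ Ω
  mem : ∀ p, X p ∈ Ω
  pos : 0 < h
  fill : ∀ y ∈ Ω, ∃ p, dist y (X p) ≤ h
  card_le : ∀ (y : EuclideanSpace ℝ (Fin d)) (F : Finset (Fin N)),
    (∀ p ∈ F, dist (X p) y ≤ 4 * h) → F.card ≤ D

/-- The `p`-th point lies strictly between the two faces of `B_v` in direction `i`. -/
def IsInside (X : Fin N → EuclideanSpace ℝ (Fin d)) (v : Finset (Fin N)) (i : Fin d)
    (p : Fin N) : Prop :=
  boxLower X v i < X p i ∧ X p i < boxUpper X v i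

theorem IsInside.mono {i : Fin d} {p : Fin N} (hp : IsInside X v i p) (hv : v.Nonempty)
    (h : v ⊆ u) : IsInside X u i p :=
  ⟨(boxLower_anti hv h i).trans_lt hp.1, hp.2.trans_le (boxUpper_mono hv h i)⟩

/-- For every set `S` of directions, `v` is obtained by restricting, in the other directions
only, a larger cluster `u` which is long in some direction of `S`. -/
def IsControlled (X : Fin N → EuclideanSpace ℝ (Fin d)) (A κ : ℝ) (v : Finset (Fin N)) : Prop :=
  ∀ S : Finset (Fin d), S.Nonempty → ∃ u, v ⊆ u ∧
    (∀ p, (∀ i ∈ S, IsInside X u i p) → (∀ i ∉ S, IsInside X v i p) → p ∈ v) ∧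
    (∃ j ∈ S, κ * maxEdge X u ≤ edgeLength X u j) ∧ (u = v ∨ IsShapeRegular X A u)

theorem IsControlled.mem_of_isInside {A κ : ℝ} (hd : 0 < d) (hc : IsControlled X A κ v)
    (hv : v.Nonempty) {p : Fin N} (hp : ∀ i, IsInside X v i p) : p ∈ v := by
  obtain ⟨u, hvu, hu, -⟩ := hc Finset.univ ⟨⟨0, hd⟩, Finset.mem_univ _⟩
  exact hu p (fun i _ => (hp i).mono hv hvu) fun i _ => hp i

/-- Contract `u` towards a central point of `v` until the displacement is small against the edges
outside `S`. The net points next to the contracted copy then belong to `v`, so `v` inherits a share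
of the long edge of `u` in `S`. -/
theorem IsControlled.exists_le_mul_edgeLength {A κ : ℝ} (hc : IsControlled X A κ v) (hd : 0 < d)
    (hnet : IsNet Ω X h D) (hA : 0 < A) (hκ : 0 < κ) (hκ1 : κ ≤ 1) (hv : v.Nonempty)
    {S : Finset (Fin d)} (hS : S.Nonempty) {r : ℝ} (hr : ∀ i ∉ S, r ≤ edgeLength X v i)
    (hrv : r ≤ maxEdge X v) (hr₁ : h * (16 * d ^ 2 * A) < r) (hr₂ : h * (32 * d / κ) ≤ r) :
    ∃ j ∈ S, r ≤ 16 * d / κ * edgeLength X v j := by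
  have hd1 : (1 : ℝ) ≤ d := by exact_mod_cast hd
  have hh := hnet.pos
  obtain ⟨u, hvu, hmem, ⟨j, hjS, hj⟩, hu⟩ := hc S hS
  have hr0 : 0 < r := lt_of_le_of_lt (by positivity) hr₁
  refine ⟨j, hjS, ?_⟩
  rcases hu with rfl | hreg
  · have h₁ : r * κ ≤ edgeLength X u j := by nlinarith
    have h₂ : r ≤ edgeLength X u j / κ := by rwa [le_div_iff₀ hκ]
    have h₃ := edgeLength_nonneg (X := X) hv j
    calc r ≤ edgeLength X u j / κ := h₂
      _ ≤ 16 * d * (edgeLength X u j / κ) := le_mul_of_one_le_left (by positivity) (by linarith)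
      _ = 16 * d / κ * edgeLength X u j := by ring
  have hun : u.Nonempty := hv.mono hvu
  set W := maxEdge X u with hW
  have hvW : maxEdge X v ≤ W := maxEdge_mono hd hv hvu
  have hW0 : 0 < W := hr0.trans_le (hrv.trans hvW)
  obtain ⟨pv, hpv, hpvi⟩ := exists_central_point hd hnet.convex hnet.mem hv
  obtain ⟨pu, hpu, hpui⟩ := exists_central_point hd hnet.convex hnet.mem hun
  -- The displacement is at most `t * W = r / (4 * d)`, half of the margin `r / (2 * d)` of `pv`
  -- outside `S`; the other half absorbs `h`.
  obtain ⟨t, htdef⟩ : ∃ t, t = r / (4 * d * W) := ⟨_, rfl⟩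
  have ht0 : 0 < t := by rw [htdef]; positivity
  have htW : t * W = r / (4 * d) := by rw [htdef]; field_simp
  have hh4 : h < r / (4 * d) := by
    rw [lt_div_iff₀ (by positivity)]
    have : (1 : ℝ) ≤ 1 / κ := by rwa [le_div_iff₀ hκ, one_mul]
    have h₁ : h * (32 * d) ≤ h * (32 * d / κ) := by
      rw [div_eq_mul_one_div (32 * (d : ℝ)) κ]
      exact mul_le_mul_of_nonneg_left (le_mul_of_one_le_right (by positivity) this) hh.le
    have : 0 < h * d := by positivity
    linarith
  have ht1 : t ≤ 1 := by
    rw [htdef, div_le_one (by positivity)]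
    nlinarith
  -- Averaging `b` with the central point `pu` keeps the copy away from the faces of `u`, which is
  -- needed for the directions in `S`.
  have key : ∀ b ∈ u, ∃ p ∈ v, |((1 - t) * pv j + t * (1 / 2 * pu j + 1 / 2 * X b j)) - X p j| ≤ h := by
    intro b hb
    obtain ⟨y, hy⟩ : ∃ y, y = (1 - t) • pv + t • ((1 / 2 : ℝ) • pu + (1 / 2 : ℝ) • X b) :=
      ⟨_, rfl⟩
    have hyΩ : y ∈ Ω := by
      rw [hy]
      refine hnet.convex hpv (hnet.convex hpu (hnet.mem b) ?_ ?_ ?_) ?_ ht0.le ?_ <;> linarith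
    have hyi : ∀ i, y i = (1 - t) * pv i + t * (1 / 2 * pu i + 1 / 2 * X b i) := fun i => by
      simp [hy, mul_add]
    obtain ⟨p, hp⟩ := hnet.fill y hyΩ
    have hpi : ∀ i, |y i - X p i| ≤ h := fun i => (abs_sub_apply_le_dist _ _ i).trans hp
    refine ⟨p, hmem p (fun i hi => ?_) (fun i hi => ?_), by rw [← hyi]; exact hpi j⟩
    · have h₁ := abs_le.1 (hpi i)
      rw [hyi] at h₁
      have hev : 0 ≤ edgeLength X v i / (2 * d) :=
        div_nonneg (edgeLength_nonneg hv i) (by positivity)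
      have a₁ : boxLower X u i ≤ pv i := by
        linarith [boxLower_anti (X := X) hv hvu i, (hpvi i).1]
      have a₂ : pv i ≤ boxUpper X u i := by
        linarith [boxUpper_mono (X := X) hv hvu i, (hpvi i).2]
      have a₃ := mul_le_mul_of_nonneg_left a₁ (sub_nonneg.2 ht1)
      have a₄ := mul_le_mul_of_nonneg_left a₂ (sub_nonneg.2 ht1)
      have b₁ : boxLower X u i + edgeLength X u i / (2 * d) / 2 ≤ 1 / 2 * pu i + 1 / 2 * X b i := by
        linarith [(hpui i).1, boxLower_le (X := X) hb i]
      have b₂ : 1 / 2 * pu i + 1 / 2 * X b i ≤ boxUpper X u i - edgeLength X u i / (2 * d) / 2 := by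
        linarith [(hpui i).2, le_boxUpper (X := X) hb i]
      have b₃ := mul_le_mul_of_nonneg_left b₁ ht0.le
      have b₄ := mul_le_mul_of_nonneg_left b₂ ht0.le
      have hm : h < t * (edgeLength X u i / (2 * d) / 2) := by
        have : r / (16 * d ^ 2 * A) ≤ t * (edgeLength X u i / (2 * d) / 2) := by
          have e₁ : r / (16 * d ^ 2 * A) = t * (W / A / (2 * d) / 2) := by
            rw [show t * (W / A / (2 * d) / 2) = t * W / (4 * d * A) by field_simp; norm_num, htW]
            field_simp; norm_num
          rw [e₁]
          have : W / A ≤ edgeLength X u i := by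
            rw [div_le_iff₀ hA, mul_comm]; exact hreg i
          gcongr
        refine lt_of_lt_of_le ?_ this
        rwa [lt_div_iff₀ (by positivity)]
      rw [mul_add t (boxLower X u i)] at b₃
      rw [mul_sub t (boxUpper X u i)] at b₄
      constructor <;> linarith [h₁.1, h₁.2]
    · have h₁ := abs_le.1 (hpi i)
      rw [hyi] at h₁
      have hq : |1 / 2 * pu i + 1 / 2 * X b i - pv i| ≤ W := by
        have hev : 0 ≤ edgeLength X v i / (2 * d) :=
          div_nonneg (edgeLength_nonneg hv i) (by positivity)
        have heu : 0 ≤ edgeLength X u i / (2 * d) :=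
          div_nonneg (edgeLength_nonneg hun i) (by positivity)
        have h₂ := edgeLength_le_maxEdge (X := X) (v := u) i
        have h₃ : edgeLength X u i = boxUpper X u i - boxLower X u i := rfl
        have h₄ := hpvi i
        have h₅ := hpui i
        rw [abs_le]
        constructor <;> linarith [boxLower_anti (X := X) hv hvu i, boxUpper_mono (X := X) hv hvu i,
          boxLower_le (X := X) hb i, le_boxUpper (X := X) hb i, h₄.1, h₄.2, h₅.1, h₅.2]
      have hq' := abs_le.1 hq
      have c₁ := mul_le_mul_of_nonneg_left hq'.1 ht0.le
      have c₂ := mul_le_mul_of_nonneg_left hq'.2 ht0.le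
      have hri : r / (4 * d) * 2 ≤ edgeLength X v i / (2 * d) := by
        rw [show r / (4 * d) * 2 = r / (2 * d) by field_simp; norm_num]
        have := hr i hi
        gcongr
      have h₄ := hpvi i
      have e : (1 - t) * pv i + t * (1 / 2 * pu i + 1 / 2 * X b i) =
          pv i + t * (1 / 2 * pu i + 1 / 2 * X b i - pv i) := by ring
      rw [e] at h₁
      rw [mul_neg, htW] at c₁
      rw [htW] at c₂
      constructor <;> linarith [h₁.1, h₁.2, h₄.1, h₄.2]
  -- The copies of two extremal points of `u` in direction `j` are `t * edgeLength X u j / 2` apart,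
  -- up to `2 * h`.
  obtain ⟨b, hb, hbj⟩ := exists_eq_boxLower (X := X) hun j
  obtain ⟨b', hb', hbj'⟩ := exists_eq_boxUpper (X := X) hun j
  obtain ⟨p, hp, hpj⟩ := key b hb
  obtain ⟨p', hp', hpj'⟩ := key b' hb'
  have h₁ := sub_le_edgeLength (X := X) hp' hp j
  have h₂ := abs_le.1 hpj
  have h₃ := abs_le.1 hpj'
  rw [hbj] at h₂
  rw [hbj'] at h₃
  have h₄ : edgeLength X u j = boxUpper X u j - boxLower X u j := rfl
  have h₅ : t * edgeLength X u j / 2 - 2 * h ≤ edgeLength X v j := by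
    rw [h₄]
    linarith [h₂.1, h₂.2, h₃.1, h₃.2]
  have h₆ : κ * (t * W) ≤ t * edgeLength X u j := by
    linarith [mul_le_mul_of_nonneg_left hj ht0.le]
  rw [htW] at h₆
  have h₇ : 4 * h ≤ κ * (r / (8 * d)) := by
    rw [show κ * (r / (8 * d)) = r / (8 * d / κ) by field_simp, le_div_iff₀ (by positivity)]
    calc 4 * h * (8 * d / κ) = h * (32 * d / κ) := by ring
      _ ≤ r := hr₂
  have e₁ : κ * (r / (4 * d)) = 2 * (κ * (r / (8 * d))) := by field_simp; norm_num
  have h₈ : κ * (r / (8 * d)) / 2 ≤ edgeLength X v j := by linarith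
  calc r = 16 * d / κ * (κ * (r / (8 * d)) / 2) := by field_simp; norm_num
    _ ≤ 16 * d / κ * edgeLength X v j := by gcongr

/-- Let `S` consist of the directions whose edges are too short by a factor `B ^ k`. The previous
lemma finds in `S` an edge that is not too short by `B ^ (k + 1)`, so the set shrinks strictly with
`k` and is empty for `k = d`. `T` makes the edges large against `h` in all `d` steps. -/
theorem IsControlled.isShapeRegular {A κ T : ℝ} (hc : IsControlled X A κ v) (hd : 0 < d)
    (hnet : IsNet Ω X h D) (hκ : 0 < κ) (hκ1 : κ ≤ 1) (hA : A = (16 * d / κ) ^ d)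
    (hT : 32 * d ^ 2 * A ^ 2 / κ ≤ T) (hv : v.Nonempty) (hTv : T * h ≤ maxEdge X v) :
    IsShapeRegular X A v := by
  have hd1 : (1 : ℝ) ≤ d := by exact_mod_cast hd
  have hh := hnet.pos
  set B : ℝ := 16 * d / κ with hB
  have hB1 : 1 ≤ B := by rw [hB, le_div_iff₀ hκ]; linarith
  have hA1 : 1 ≤ A := hA ▸ one_le_pow₀ hB1
  have hBk : ∀ k, k ≤ d → B ^ k ≤ A := fun k hk => hA ▸ pow_le_pow_right₀ hB1 hk
  have hT₁ : 16 * d ^ 2 * A * A < T := by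
    refine lt_of_lt_of_le ?_ hT
    rw [lt_div_iff₀ hκ]
    have : 0 < (d : ℝ) ^ 2 * A ^ 2 := by positivity
    nlinarith
  have hT₂ : 32 * d / κ * A ≤ T := by
    refine le_trans ?_ hT
    rw [div_mul_eq_mul_div]
    gcongr 32 * ?_ * ?_ / κ
    · exact le_self_pow₀ hd1 two_ne_zero
    · exact le_self_pow₀ hA1 two_ne_zero
  intro i₀
  by_contra! hlt
  have hcard : ∀ k, k ≤ d →
      (Finset.univ.filter fun i => B ^ k * edgeLength X v i < maxEdge X v).card + k ≤ d := by
    intro k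
    induction k with
    | zero =>
      intro _
      rw [add_zero]
      exact (Finset.card_le_univ _).trans (Fintype.card_fin d).le
    | succ k ih =>
      intro hk
      have hmul : ∀ e, maxEdge X v / B ^ k ≤ e ↔ maxEdge X v ≤ B ^ k * e := fun e => by
        rw [div_le_iff₀ (by positivity), mul_comm]
      have hlarge : ∀ b, b * A ≤ T → h * b ≤ maxEdge X v / B ^ k := fun b hb => by
        rw [le_div_iff₀ (by positivity)]
        rcases le_or_gt 0 b with hb0 | hb0
        · calc h * b * B ^ k ≤ h * b * A := by gcongr; exact hBk k (by omega)
            _ = b * A * h := by ring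
            _ ≤ T * h := by gcongr
            _ ≤ _ := hTv
        · have : h * b * B ^ k ≤ 0 :=
            mul_nonpos_of_nonpos_of_nonneg (mul_nonpos_of_nonneg_of_nonpos hh.le hb0.le)
              (by positivity)
          exact this.trans (maxEdge_nonneg hv)
      have hstrict : h * (16 * d ^ 2 * A) < maxEdge X v / B ^ k := by
        rw [lt_div_iff₀ (by positivity)]
        calc h * (16 * d ^ 2 * A) * B ^ k ≤ h * (16 * d ^ 2 * A) * A := by
              gcongr; exact hBk k (by omega)
          _ = 16 * d ^ 2 * A * A * h := by ring
          _ < T * h := by gcongr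
          _ ≤ _ := hTv
      obtain ⟨j, hjS, hj⟩ := hc.exists_le_mul_edgeLength hd hnet (by linarith) hκ hκ1 hv
        (S := Finset.univ.filter fun i => B ^ k * edgeLength X v i < maxEdge X v)
        (r := maxEdge X v / B ^ k)
        ⟨i₀, by
          rw [Finset.mem_filter]
          refine ⟨Finset.mem_univ _, lt_of_le_of_lt ?_ hlt⟩
          exact mul_le_mul_of_nonneg_right (hBk k (by omega)) (edgeLength_nonneg hv _)⟩
        (fun i hi => by
          rw [hmul]
          simpa using hi)
        (div_le_self (maxEdge_nonneg hv) (one_le_pow₀ hB1)) hstrict (hlarge _ hT₂)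
      have hsub : (Finset.univ.filter fun i => B ^ (k + 1) * edgeLength X v i < maxEdge X v) ⊂
          Finset.univ.filter fun i => B ^ k * edgeLength X v i < maxEdge X v := by
        rw [Finset.ssubset_iff_of_subset]
        · refine ⟨j, hjS, ?_⟩
          rw [hmul, ← mul_assoc, ← pow_succ] at hj
          simpa using hj
        · intro i hi
          rw [Finset.mem_filter] at hi ⊢
          refine ⟨hi.1, lt_of_le_of_lt ?_ hi.2⟩
          exact mul_le_mul_of_nonneg_right (pow_le_pow_right₀ hB1 (by omega))
            (edgeLength_nonneg hv _)
      have h₁ := Finset.card_lt_card hsub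
      have h₂ := ih (by omega)
      omega
  have h₁ := hcard d le_rfl
  have h₂ : 0 < (Finset.univ.filter fun i => B ^ d * edgeLength X v i < maxEdge X v).card :=
    Finset.card_pos.2 ⟨i₀, by
      rw [Finset.mem_filter, ← hA]
      exact ⟨Finset.mem_univ _, hlt⟩⟩
  omega

/-- Only direction `ℓ` is newly cut. If `ℓ ∈ S`, the son itself serves as `u`, being long in
direction `ℓ` by `maxEdge_div_le_edgeLength`. Otherwise the `u` of the parent still serves. -/
theorem IsControlled.child {A κ T : ℝ} (hc : IsControlled X A κ v) (hd : 0 < d)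
    (hnet : IsNet Ω X h D) (hκ : 0 < κ) (hκD : κ ≤ 1 / (128 * 16 ^ (4 * D + 1)))
    (hA : A = (16 * d / κ) ^ d) (hT : 32 * d ^ 2 * A ^ 2 / κ ≤ T) (hw : w.Nonempty)
    (hwv : w ⊆ v) (hcard : v.card ≤ 4 * w.card) {ℓ : Fin d}
    (hℓ : ∀ i, edgeLength X v i ≤ edgeLength X v ℓ)
    (hcut : ∀ p ∈ v, p ∉ w → (∀ p' ∈ w, X p ℓ ≤ X p' ℓ) ∨ ∀ p' ∈ w, X p' ℓ ≤ X p ℓ)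
    (hTw : T * h ≤ maxEdge X w) : IsControlled X A κ w := by
  have hd1 : (1 : ℝ) ≤ d := by exact_mod_cast hd
  have hh := hnet.pos
  have hv : v.Nonempty := hw.mono hwv
  have hwv' := maxEdge_mono (X := X) hd hw hwv
  have hTv : T * h ≤ maxEdge X v := hTw.trans hwv'
  have hP : (1 : ℝ) ≤ 16 ^ (4 * D + 1) := one_le_pow₀ (by norm_num)
  have hκP : κ * (128 * 16 ^ (4 * D + 1)) ≤ 1 := by
    rwa [le_div_iff₀ (by positivity)] at hκD
  have hκ1 : κ ≤ 1 := by nlinarith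
  have hA1 : 1 ≤ A := by
    rw [hA]
    refine one_le_pow₀ ?_
    rw [le_div_iff₀ hκ]
    linarith
  have hreg := hc.isShapeRegular hd hnet hκ hκ1 hA hT hv hTv
  have hmem : ∀ p ∈ v, IsInside X w ℓ p → p ∈ w := by
    intro p hp hpw
    by_contra hpn
    rcases hcut p hp hpn with h₁ | h₁
    · obtain ⟨b, hb, hbℓ⟩ := exists_eq_boxLower (X := X) hw ℓ
      linarith [h₁ b hb, hpw.1]
    · obtain ⟨b, hb, hbℓ⟩ := exists_eq_boxUpper (X := X) hw ℓ
      linarith [h₁ b hb, hpw.2]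
  have hT' : 32 * d ^ 2 * A ^ 2 ≤ T * κ := by rwa [div_le_iff₀ hκ] at hT
  have hdA : d * A ≤ d ^ 2 * A ^ 2 := by
    rw [← mul_pow]
    exact le_self_pow₀ (one_le_mul_of_one_le_of_one_le hd1 hA1) two_ne_zero
  have hT0 : 0 < T := lt_of_lt_of_le (by positivity) hT
  have hT₃ : 8 * d * A * 16 ^ (4 * D + 1) < T := by
    have h₁ : T * (κ * (128 * 16 ^ (4 * D + 1))) ≤ T := mul_le_of_le_one_right hT0.le hκP
    have h₂ : 32 * (d * A) * (128 * 16 ^ (4 * D + 1)) ≤ T * κ * (128 * 16 ^ (4 * D + 1)) := by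
      refine mul_le_mul_of_nonneg_right ?_ (by positivity)
      linarith
    have h₃ : 0 < d * A * 16 ^ (4 * D + 1) := by positivity
    linarith
  have hT₄ : 128 * 16 ^ (4 * D + 1) ≤ T := by
    have h₁ : T * (κ * (128 * 16 ^ (4 * D + 1))) ≤ T := mul_le_of_le_one_right hT0.le hκP
    have h₂ : 1 * (128 * 16 ^ (4 * D + 1)) ≤ T * κ * (128 * 16 ^ (4 * D + 1)) := by
      refine mul_le_mul_of_nonneg_right ?_ (by positivity)
      nlinarith [one_le_mul_of_one_le_of_one_le hd1 hA1]
    linarith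
  intro S hS
  by_cases hℓS : ℓ ∈ S
  · refine ⟨w, subset_rfl, fun p h₁ h₂ => ?_, ⟨ℓ, hℓS, ?_⟩, Or.inl rfl⟩
    · have hin : ∀ i, IsInside X w i p := fun i =>
        if hi : i ∈ S then h₁ i hi else h₂ i hi
      exact hmem p (hc.mem_of_isInside hd hv fun i => (hin i).mono hw hwv) (hin ℓ)
    · have h₁ := maxEdge_div_le_edgeLength hd hnet.convex hnet.mem hh hnet.fill hnet.card_le hw hwv
        hcard (fun p hp => hc.mem_of_isInside hd hv hp) (by linarith) hreg (maxEdge_eq hℓ).symm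
        (lt_of_lt_of_le (by rw [mul_comm h]; gcongr) hTv)
        (le_trans (by rw [mul_comm h]; gcongr) hTv)
      refine le_trans ?_ h₁
      rw [div_eq_mul_one_div, mul_comm]
      exact mul_le_mul hwv' hκD hκ.le (maxEdge_nonneg hv)
  · obtain ⟨u, hvu, hu, hj, hur⟩ := hc S hS
    refine ⟨u, hwv.trans hvu, fun p h₁ h₂ => ?_, hj, Or.inr ?_⟩
    · exact hmem p (hu p h₁ fun i hi => (h₂ i hi).mono hw hwv) (h₂ ℓ hℓS)
    -- If `u` was the parent itself, its regularity must now be supplied; it follows from the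
    -- parent's own control.
    · rcases hur with rfl | hur
      · exact hreg
      · exact hur

end Control

/-! ### Size of regular clusters, and control at the root. -/

section Size

variable {d N : ℕ} {Ω : Set (EuclideanSpace ℝ (Fin d))} {X : Fin N → EuclideanSpace ℝ (Fin d)}
  {u v w : Finset (Fin N)} {h : ℝ} {D : ℕ}

theorem maxEdge_le_of_subset_ball (hd : 0 < d) (hX : ∀ p, X p ∈ Ω) {x₀ : EuclideanSpace ℝ (Fin d)}
    {R : ℝ} (hR : Ω ⊆ Metric.closedBall x₀ R) (hv : v.Nonempty) : maxEdge X v ≤ 2 * R := by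
  have : Nonempty (Fin d) := ⟨⟨0, hd⟩⟩
  refine ciSup_le fun i => ?_
  obtain ⟨b, hb, hbi⟩ := exists_eq_boxLower (X := X) hv i
  obtain ⟨b', hb', hbi'⟩ := exists_eq_boxUpper (X := X) hv i
  unfold edgeLength
  rw [← hbi, ← hbi']
  have h₁ := abs_sub_apply_le_dist (X b') (X b) i
  have h₂ := Metric.mem_closedBall.1 (hR (hX b))
  have h₃ := Metric.mem_closedBall.1 (hR (hX b'))
  linarith [le_abs_self (X b' i - X b i), dist_triangle_right (X b') (X b) x₀]

/-- A shape regular cluster of a convex body contains as many points as its volume suggests. -/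
theorem maxEdge_pow_le_of_isShapeRegular (hd : 0 < d) (hnet : IsNet Ω X h D)
    {x₀ : EuclideanSpace ℝ (Fin d)} {r R A : ℝ} (hr : 0 < r) (hrR : r ≤ R)
    (hball : Metric.ball x₀ r ⊆ Ω) (hR : Ω ⊆ Metric.closedBall x₀ R) (hA1 : 1 ≤ A)
    (hv : v.Nonempty) (hreg : IsShapeRegular X A v)
    (hmem : ∀ p, (∀ i, IsInside X v i p) → p ∈ v) (hlarge : 8 * d * A * R / r * h ≤ maxEdge X v) :
    maxEdge X v ^ d ≤ (8 * d * A * R / r * h) ^ d * v.card := by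
  have hd1 : (1 : ℝ) ≤ d := by exact_mod_cast hd
  have hh := hnet.pos
  have hR0 : 0 < R := hr.trans_le hrR
  have hM2 := maxEdge_le_of_subset_ball hd hnet.mem hR hv
  set M := maxEdge X v with hM
  have hM0 : 0 < M := lt_of_lt_of_le (by positivity) hlarge
  obtain ⟨p, hp, hpi⟩ := exists_central_point hd hnet.convex hnet.mem hv
  -- The homothety with centre `p` and ratio `t` maps the inner ball of `Ω` to a ball in `Ω`. With
  -- this `t` its points are within `2 * t * R` of `p`, which is at most the margin of `p` in the
  -- box.
  obtain ⟨t, ht⟩ : ∃ t, t = M / (4 * d * A * R) := ⟨_, rfl⟩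
  have ht0 : 0 < t := by rw [ht]; positivity
  have htR : 2 * (t * R) = M / (2 * d * A) := by rw [ht]; field_simp; norm_num
  have ht1 : t ≤ 1 := by
    rw [ht, div_le_one (by positivity)]
    have : 1 ≤ d * A := one_le_mul_of_one_le_of_one_le hd1 hA1
    nlinarith
  have htr : M = 4 * d * A * R / r * (t * r) := by rw [ht]; field_simp
  have hG : 0 < 4 * d * A * R / r := by positivity
  have hρh : 2 * h ≤ t * r := by
    refine le_of_mul_le_mul_left (a := 4 * d * A * R / r) ?_ hG
    rw [← htr]
    exact le_trans (by ring_nf; rfl) hlarge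
  obtain ⟨z, hz⟩ : ∃ z, z = (1 - t) • p + t • x₀ := ⟨_, rfl⟩
  have hpx : dist p x₀ ≤ R := hR hp
  have hzp : dist z p ≤ t * R := by
    have : z - p = t • (x₀ - p) := by rw [hz]; module
    rw [dist_eq_norm, this, norm_smul, Real.norm_of_nonneg ht0.le, ← dist_eq_norm, dist_comm]
    gcongr
  have hzball : Metric.ball z (t * r) ⊆ Ω := by
    intro x hx
    have hxe : x = (1 - t) • p + t • (x₀ + t⁻¹ • (x - z)) := by
      rw [smul_add, smul_smul, mul_inv_cancel₀ ht0.ne', one_smul, ← add_assoc, ← hz]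
      abel
    rw [hxe]
    refine hnet.convex hp (hball ?_) (by linarith) ht0.le (by ring)
    rw [Metric.mem_ball, dist_eq_norm] at hx ⊢
    rw [add_sub_cancel_left, norm_smul, Real.norm_of_nonneg (by positivity),
      inv_mul_lt_iff₀ ht0]
    exact hx
  have hcard := le_card_of_fill hh (by linarith) hnet.fill z hzball v (by
    intro b hb
    refine hmem b fun i => ?_
    have h₁ := abs_sub_apply_le_dist (X b) p i
    have h₂ : dist (X b) p < 2 * (t * R) := by
      have := dist_triangle (X b) z p
      have : t * r ≤ t * R := by gcongr
      linarith
    have h₃ : 2 * (t * R) ≤ edgeLength X v i / (2 * d) := by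
      rw [htR, div_le_div_iff₀ (by positivity) (by positivity)]
      nlinarith [hreg i]
    have h₄ := abs_lt.1 (h₁.trans_lt (h₂.trans_le h₃))
    have h₅ := hpi i
    constructor <;> linarith [h₄.1, h₄.2, h₅.1, h₅.2])
  have hstep : M ≤ 8 * d * A * R / r * h * ((t * r - h) / h) := by
    calc M = 4 * d * A * R / r * (t * r) := htr
      _ ≤ 4 * d * A * R / r * (2 * (t * r - h)) := by
        refine mul_le_mul_of_nonneg_left ?_ hG.le
        linarith
      _ = _ := by field_simp; ring
  calc M ^ d ≤ (8 * d * A * R / r * h * ((t * r - h) / h)) ^ d := by gcongr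
    _ = (8 * d * A * R / r * h) ^ d * ((t * r - h) / h) ^ d := mul_pow _ _ _
    _ ≤ _ := by gcongr

/-- The root serves as `u` for every `S`: net points near `x₀` shifted by `± r / 2` along an axis
make each edge at least `r / 2`, while no edge exceeds `2 * R`. -/
theorem isControlled_univ (hd : 0 < d) (hnet : IsNet Ω X h D) {x₀ : EuclideanSpace ℝ (Fin d)}
    {r R A κ : ℝ} (hr : 0 < r) (hball : Metric.ball x₀ r ⊆ Ω) (hR : Ω ⊆ Metric.closedBall x₀ R)
    (hR0 : 0 < R) (hκr : κ ≤ r / (4 * R))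
    (hne : (Finset.univ : Finset (Fin N)).Nonempty)
    (hlarge : 8 * R / r * h ≤ maxEdge X Finset.univ) : IsControlled X A κ Finset.univ := by
  have hM := maxEdge_le_of_subset_ball hd hnet.mem hR hne
  have hh : 4 * h ≤ r := by
    have h₁ := hlarge.trans hM
    rw [div_mul_eq_mul_div, div_le_iff₀ hr] at h₁
    nlinarith
  intro S hS
  obtain ⟨j, hj⟩ := hS
  refine ⟨Finset.univ, subset_rfl, fun p _ _ => Finset.mem_univ p, ⟨j, hj, ?_⟩, Or.inl rfl⟩
  have key : ∀ σ : ℝ, |σ| = 1 → ∃ p, |x₀ j + σ * (r / 2) - X p j| ≤ h := by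
    intro σ hσ
    obtain ⟨p, hp⟩ := hnet.fill (x₀ + (σ * (r / 2)) • EuclideanSpace.single j 1) (hball (by
      rw [Metric.mem_ball, dist_eq_norm, add_sub_cancel_left, norm_smul, Real.norm_eq_abs,
        abs_mul, hσ, abs_of_pos (half_pos hr)]
      simp [hr]))
    refine ⟨p, ?_⟩
    have := (abs_sub_apply_le_dist _ _ j).trans hp
    simpa using this
  obtain ⟨p, hp⟩ := key 1 (by simp)
  obtain ⟨p', hp'⟩ := key (-1) (by simp)
  have h₁ := sub_le_edgeLength (X := X) (Finset.mem_univ p) (Finset.mem_univ p') j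
  have h₂ := abs_le.1 hp
  have h₃ := abs_le.1 hp'
  have h₀ := maxEdge_nonneg (X := X) hne
  have h₄ : κ * maxEdge X Finset.univ ≤ r / 2 := by
    calc κ * maxEdge X Finset.univ ≤ r / (4 * R) * (2 * R) := by gcongr
      _ = r / 2 := by field_simp; norm_num
  linarith [h₂.1, h₂.2, h₃.1, h₃.2]

end Size

/-! ### Cluster sizes, depth and box sizes in the tree. -/

section Tree

variable {d N : ℕ} {Ω : Set (EuclideanSpace ℝ (Fin d))} {X : Fin N → EuclideanSpace ℝ (Fin d)}
  {h : ℝ} {D m : ℕ}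

/-- `t.IsClusterAt j w`: the cluster `w` belongs to the tree `t` at depth `j`. -/
def ClusterTree.IsClusterAt {N : ℕ} : ClusterTree N → ℕ → Finset (Fin N) → Prop
  | .leaf v, j, w => j = 0 ∧ w = v
  | .node v _ _, 0, w => w = v
  | .node _ l r, j + 1, w => l.IsClusterAt j w ∨ r.IsClusterAt j w

theorem ClusterTree.isClusterAt_cluster (t : ClusterTree N) : t.IsClusterAt 0 t.cluster := by
  cases t <;> simp [IsClusterAt, cluster]

theorem ClusterTree.IsBisection.nonempty {t : ClusterTree N} (ht : t.IsBisection X m) :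
    t.cluster.Nonempty := by
  cases t with
  | leaf v => exact ht.1
  | node v l r =>
    obtain ⟨hs, -, -⟩ := ht
    show v.Nonempty
    rw [← hs.union]
    exact hs.nonempty₁.mono Finset.subset_union_left

theorem IsMedianSplit.card_add {v v₁ v₂ : Finset (Fin N)} (hs : IsMedianSplit X v v₁ v₂) :
    v₁.card + v₂.card = v.card := by
  rw [← Finset.card_union_of_disjoint hs.disjoint, hs.union]

theorem ClusterTree.IsClusterAt.subset {t : ClusterTree N} (ht : t.IsBisection X m) {j : ℕ}
    {w : Finset (Fin N)} (hw : t.IsClusterAt j w) : w ⊆ t.cluster := by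
  induction t generalizing j with
  | leaf v => exact hw.2.subset
  | node v l r ihl ihr =>
    obtain ⟨hs, hl, hr⟩ := ht
    cases j with
    | zero => exact (show w = v from hw).subset
    | succ j =>
      show w ⊆ v
      rw [← hs.union]
      rcases hw with hw | hw
      · exact (ihl hl hw).trans Finset.subset_union_left
      · exact (ihr hr hw).trans Finset.subset_union_right

theorem ClusterTree.IsClusterAt.nonempty {t : ClusterTree N} (ht : t.IsBisection X m) {j : ℕ}
    {w : Finset (Fin N)} (hw : t.IsClusterAt j w) : w.Nonempty := by
  induction t generalizing j with
  | leaf v => exact hw.2 ▸ ht.1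
  | node v l r ihl ihr =>
    cases j with
    | zero => exact (show w = v from hw) ▸ ht.nonempty
    | succ j =>
      rcases hw with hw | hw
      · exact ihl ht.2.1 hw
      · exact ihr ht.2.2 hw

theorem ClusterTree.IsClusterAt.disjoint {t : ClusterTree N} (ht : t.IsBisection X m) {j : ℕ}
    {w w' : Finset (Fin N)} (hw : t.IsClusterAt j w) (hw' : t.IsClusterAt j w') (hne : w ≠ w') :
    Disjoint w w' := by
  induction t generalizing j with
  | leaf v => exact (hne (hw.2.trans hw'.2.symm)).elim
  | node v l r ihl ihr =>
    obtain ⟨hs, hl, hr⟩ := ht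
    cases j with
    | zero => exact (hne ((show w = v from hw).trans (show w' = v from hw').symm)).elim
    | succ j =>
      rcases hw with hw | hw <;> rcases hw' with hw' | hw'
      · exact ihl hl hw hw'
      · exact hs.disjoint.mono (hw.subset hl) (hw'.subset hr)
      · exact (hs.disjoint.mono (hw'.subset hl) (hw.subset hr)).symm
      · exact ihr hr hw hw'

/-- Sons of sizes differing by at most 2 have between `n / 2 - 1` and `n / 2 + 1` points. The shifts
by 2 turn these bounds into exact halving, which iterates. -/
theorem ClusterTree.IsClusterAt.card_bounds {t : ClusterTree N} (ht : t.IsBisection X m) {j : ℕ}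
    {w : Finset (Fin N)} (hw : t.IsClusterAt j w) :
    2 ^ j * ((w.card : ℝ) - 2) ≤ t.cluster.card - 2 ∧
      (t.cluster.card : ℝ) + 2 ≤ 2 ^ j * ((w.card : ℝ) + 2) := by
  induction t generalizing j with
  | leaf v => rw [hw.1, hw.2]; simp [cluster]
  | node v l r ihl ihr =>
    obtain ⟨hs, hl, hr⟩ := ht
    have hc : (l.cluster.card : ℝ) + r.cluster.card = v.card := by exact_mod_cast hs.card_add
    have h₁ : (l.cluster.card : ℝ) ≤ r.cluster.card + 2 := by exact_mod_cast hs.card₁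
    have h₂ : (r.cluster.card : ℝ) ≤ l.cluster.card + 2 := by exact_mod_cast hs.card₂
    cases j with
    | zero => rw [show w = v from hw]; simp [cluster]
    | succ j =>
      simp only [cluster, pow_succ]
      rcases hw with hw | hw
      · obtain ⟨h₃, h₄⟩ := ihl hl hw
        constructor <;> linarith
      · obtain ⟨h₃, h₄⟩ := ihr hr hw
        constructor <;> linarith

/-- Halving up to rounding says nothing about the depth of clusters with at most 2 points. Instead,
a son has at most `3 / 4` of the points, and `2 * (3 / 4) ^ 3 < 1`. -/
theorem ClusterTree.IsClusterAt.two_pow_le {t : ClusterTree N} (ht : t.IsBisection X m) {j : ℕ}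
    {w : Finset (Fin N)} (hw : t.IsClusterAt j w) : 2 ^ j ≤ t.cluster.card ^ 3 := by
  have key : ∀ a b : ℕ, 0 < b → a ≤ b + 2 → 2 * a ^ 3 ≤ (a + b) ^ 3 := by
    intro a b hb hab
    have h₁ : a ≤ 3 * b := by omega
    nlinarith [Nat.mul_le_mul_left (a ^ 2) h₁, Nat.zero_le (a * b ^ 2), Nat.zero_le (b ^ 3)]
  induction t generalizing j with
  | leaf v =>
    rw [hw.1, pow_zero]
    exact Nat.one_le_pow _ _ ht.1.card_pos
  | node v l r ihl ihr =>
    cases j with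
    | zero =>
      rw [pow_zero]
      exact Nat.one_le_pow _ _ ht.nonempty.card_pos
    | succ j =>
      obtain ⟨hs, hl, hr⟩ := ht
      show 2 ^ (j + 1) ≤ v.card ^ 3
      rw [← hs.card_add, pow_succ]
      rcases hw with hw | hw
      · have := key _ _ hs.nonempty₂.card_pos hs.card₁
        linarith [ihl hl hw]
      · have := key _ _ hs.nonempty₁.card_pos hs.card₂
        rw [add_comm]
        linarith [ihr hr hw]

/-- Each son has a quarter of the points, as its brother has at most 2 more and it is nonempty. A
parent of a large son is large, so the conditional form passes down the tree. -/
theorem IsMedianSplit.isControlled {A κ T : ℝ} {v v₁ v₂ : Finset (Fin N)}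
    (hs : IsMedianSplit X v v₁ v₂) (hd : 0 < d) (hnet : IsNet Ω X h D) (hκ : 0 < κ)
    (hκD : κ ≤ 1 / (128 * 16 ^ (4 * D + 1))) (hA : A = (16 * d / κ) ^ d)
    (hT : 32 * d ^ 2 * A ^ 2 / κ ≤ T) (hc : T * h ≤ maxEdge X v → IsControlled X A κ v) :
    (T * h ≤ maxEdge X v₁ → IsControlled X A κ v₁) ∧
      (T * h ≤ maxEdge X v₂ → IsControlled X A κ v₂) := by
  obtain ⟨ℓ, hℓ, hcut⟩ := hs.cut
  have hcard := hs.card_add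
  have hc₁ := hs.nonempty₁.card_pos
  have hc₂ := hs.nonempty₂.card_pos
  have hcard₁ := hs.card₁
  have hcard₂ := hs.card₂
  have hsub₁ : v₁ ⊆ v := hs.union ▸ Finset.subset_union_left
  have hsub₂ : v₂ ⊆ v := hs.union ▸ Finset.subset_union_right
  have hmem : ∀ p ∈ v, p ∈ v₁ ∨ p ∈ v₂ := fun p hp => by
    rwa [← hs.union, Finset.mem_union] at hp
  constructor <;> intro hTv
  · refine (hc (hTv.trans (maxEdge_mono hd hs.nonempty₁ hsub₁))).child hd hnet hκ hκD hA hT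
      hs.nonempty₁ hsub₁ (by omega) hℓ (fun p hp hpn => Or.inl fun p' hp' => ?_) hTv
    exact hcut p' hp' p ((hmem p hp).resolve_left hpn)
  · refine (hc (hTv.trans (maxEdge_mono hd hs.nonempty₂ hsub₂))).child hd hnet hκ hκD hA hT
      hs.nonempty₂ hsub₂ (by omega) hℓ (fun p hp hpn => Or.inr fun p' hp' => ?_) hTv
    exact hcut p ((hmem p hp).resolve_right hpn) p' hp'

theorem ClusterTree.IsClusterAt.isControlled {A κ T : ℝ} (hd : 0 < d) (hnet : IsNet Ω X h D)
    (hκ : 0 < κ) (hκD : κ ≤ 1 / (128 * 16 ^ (4 * D + 1))) (hA : A = (16 * d / κ) ^ d)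
    (hT : 32 * d ^ 2 * A ^ 2 / κ ≤ T) {t : ClusterTree N} (ht : t.IsBisection X m)
    (hc : T * h ≤ maxEdge X t.cluster → IsControlled X A κ t.cluster) {j : ℕ}
    {w : Finset (Fin N)} (hw : t.IsClusterAt j w) (hTw : T * h ≤ maxEdge X w) :
    IsControlled X A κ w := by
  induction t generalizing j with
  | leaf v =>
    obtain ⟨-, rfl⟩ := hw
    exact hc hTw
  | node v l r ihl ihr =>
    obtain ⟨hs, hl, hr⟩ := ht
    cases j with
    | zero =>
      obtain rfl : w = v := hw
      exact hc hTw
    | succ j =>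
      obtain ⟨h₁, h₂⟩ := hs.isControlled hd hnet hκ hκD hA hT hc
      rcases hw with hw | hw
      · exact ihl hl h₁ hw
      · exact ihr hr h₂ hw

/-- In a bisection tree for a quasi-uniform point set on a convex body, the size of a cluster
controls the size of its bounding box. -/
theorem exists_maxEdge_pow_le (hd : 0 < d) (D : ℕ) {x₀ : EuclideanSpace ℝ (Fin d)} {r R : ℝ}
    (hr : 0 < r) (hrR : r ≤ R) (hball : Metric.ball x₀ r ⊆ Ω) (hR : Ω ⊆ Metric.closedBall x₀ R) :
    ∃ T : ℝ, 1 ≤ T ∧ ∀ (N m : ℕ) (X : Fin N → EuclideanSpace ℝ (Fin d)) (h : ℝ), IsNet Ω X h D →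
      ∀ t : ClusterTree N, IsBisectionTreeFor X m t → ∀ (j : ℕ) (w : Finset (Fin N)),
        t.IsClusterAt j w → maxEdge X w ^ d ≤ (T * h) ^ d * w.card := by
  have hd1 : (1 : ℝ) ≤ d := by exact_mod_cast hd
  have hR0 : 0 < R := hr.trans_le hrR
  -- The first bound on `κ` is the share left by a cut, the second the share available at the root.
  obtain ⟨κ, hκ, hκD, hκr⟩ : ∃ κ : ℝ, 0 < κ ∧ κ ≤ 1 / (128 * 16 ^ (4 * D + 1)) ∧
      κ ≤ r / (4 * R) :=
    ⟨min (1 / (128 * 16 ^ (4 * D + 1))) (r / (4 * R)), lt_min (by positivity) (by positivity),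
      min_le_left _ _, min_le_right _ _⟩
  have hκ1 : κ ≤ 1 := by
    refine hκD.trans ?_
    have : (1 : ℝ) ≤ 16 ^ (4 * D + 1) := one_le_pow₀ (by norm_num)
    rw [div_le_one (by positivity)]
    linarith
  obtain ⟨A, hA⟩ : ∃ A : ℝ, A = (16 * d / κ) ^ d := ⟨_, rfl⟩
  have hA1 : 1 ≤ A := by
    rw [hA]
    refine one_le_pow₀ ?_
    rw [le_div_iff₀ hκ]
    linarith
  obtain ⟨T, hT1, hT2, hT⟩ : ∃ T : ℝ, 1 ≤ T ∧ 8 * d * A * R / r ≤ T ∧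
      32 * d ^ 2 * A ^ 2 / κ ≤ T :=
    ⟨max 1 (max (8 * d * A * R / r) (32 * d ^ 2 * A ^ 2 / κ)), le_max_left _ _,
      (le_max_left _ _).trans (le_max_right _ _), (le_max_right _ _).trans (le_max_right _ _)⟩
  refine ⟨T, hT1, fun N m X h hnet t ht j w hw => ?_⟩
  have hh := hnet.pos
  have hwn := hw.nonempty ht.2
  rcases le_or_gt (T * h) (maxEdge X w) with hlarge | hsmall
  · have hc := hw.isControlled hd hnet hκ hκD hA hT ht.2 (fun hl => by
      rw [ht.1] at hl ⊢
      refine isControlled_univ hd hnet hr hball hR hR0 hκr (ht.1 ▸ ht.2.nonempty)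
        (le_trans ?_ hl)
      gcongr
      refine le_trans ?_ hT2
      have : 1 ≤ d * A := one_le_mul_of_one_le_of_one_le hd1 hA1
      gcongr
      nlinarith) hlarge
    refine (maxEdge_pow_le_of_isShapeRegular hd hnet hr hrR hball hR hA1 hwn
      (hc.isShapeRegular hd hnet hκ hκ1 hA hT hwn hlarge)
      (fun p hp => hc.mem_of_isInside hd hwn hp) (le_trans (by gcongr) hlarge)).trans ?_
    gcongr
  · calc maxEdge X w ^ d ≤ (T * h) ^ d := pow_le_pow_left₀ (maxEdge_nonneg hwn) hsmall.le d
      _ ≤ (T * h) ^ d * w.card := by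
        refine le_mul_of_one_le_right (by positivity) ?_
        exact_mod_cast hwn.card_pos

end Tree

/-! ### Number of basis elements per cluster. -/

section Basis

variable {d N q : ℕ} {X : Fin N → EuclideanSpace ℝ (Fin d)} {t : ClusterTree N}
  {Φ : List (Fin N → ℝ)} {S B : List (Finset (Fin N) × (Fin N → ℝ))}

theorem length_transformRow (Φ : List (Fin N → ℝ)) (Q : Matrix (Fin Φ.length) (Fin Φ.length) ℝ) :
    (transformRow Φ Q).length = Φ.length := by
  simp [transformRow]

theorem IsSampletConstruction.length_le (hc : IsSampletConstruction X q t Φ S)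
    (ht : t.IsBisection X (polyDim d q)) : Φ.length ≤ polyDim d q := by
  cases hc with
  | leaf v => simpa using ht.2
  | node v l r Φl Φr Sl Sr Q hl hr hQ => exact List.length_take_le _ _

theorem IsSampletConstruction.length_add (hc : IsSampletConstruction X q t Φ S)
    (ht : t.IsBisection X (polyDim d q)) : Φ.length + S.length = t.cluster.card := by
  induction hc with
  | leaf v => simp [ClusterTree.cluster]
  | node v l r Φl Φr Sl Sr Q hl hr hQ ihl ihr =>
    have h₁ := ihl ht.2.1
    have h₂ := ihr ht.2.2
    have h₃ : l.cluster.card + r.cluster.card = v.card := ht.1.card_add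
    simp only [List.length_take, List.length_append, List.length_map, List.length_drop,
      length_transformRow]
    show _ = v.card
    omega

theorem IsSampletConstruction.exists_isClusterAt (hc : IsSampletConstruction X q t Φ S) :
    ∀ x ∈ S, ∃ j, t.IsClusterAt j x.1 := by
  induction hc with
  | leaf v => simp
  | node v l r Φl Φr Sl Sr Q hl hr hQ ihl ihr =>
    intro x hx
    simp only [List.mem_append, List.mem_map] at hx
    rcases hx with ⟨σ, -, rfl⟩ | hx | hx
    · exact ⟨0, rfl⟩
    · obtain ⟨j, hj⟩ := ihl x hx
      exact ⟨j + 1, Or.inl hj⟩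
    · obtain ⟨j, hj⟩ := ihr x hx
      exact ⟨j + 1, Or.inr hj⟩

/-- The sons pass on at most `2 * polyDim d q` functions, of which the first `polyDim d q` become
scaling functions. No other node carries the same cluster, since the sons are nonempty and disjoint.
-/
theorem IsSampletConstruction.countP_le (hc : IsSampletConstruction X q t Φ S)
    (ht : t.IsBisection X (polyDim d q)) (w : Finset (Fin N)) :
    S.countP (fun x => x.1 = w) ≤ polyDim d q := by
  induction hc with
  | leaf v => simp
  | node v l r Φl Φr Sl Sr Q hl hr hQ ihl ihr =>
    obtain ⟨hs, htl, htr⟩ := ht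
    have h₁ := hl.length_le htl
    have h₂ := hr.length_le htr
    have hzero : ∀ {t' : ClusterTree N} {Φ' S'}, IsSampletConstruction X q t' Φ' S' →
        t'.IsBisection X (polyDim d q) → ¬ w ⊆ t'.cluster →
        S'.countP (fun x => x.1 = w) = 0 := by
      intro t' Φ' S' hc' ht' hw
      rw [List.countP_eq_zero]
      intro x hx
      obtain ⟨j, hj⟩ := hc'.exists_isClusterAt x hx
      simp only [decide_eq_true_eq]
      rintro rfl
      exact hw (hj.subset ht')
    have hne : ∀ {t' : ClusterTree N} {Φ' S'}, IsSampletConstruction X q t' Φ' S' →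
        t'.IsBisection X (polyDim d q) → w = ∅ → S'.countP (fun x => x.1 = w) = 0 := by
      intro t' Φ' S' hc' ht' hw
      rw [List.countP_eq_zero]
      intro x hx
      obtain ⟨j, hj⟩ := hc'.exists_isClusterAt x hx
      simp only [decide_eq_true_eq]
      rintro rfl
      exact (hj.nonempty ht').ne_empty hw
    rw [List.countP_append, List.countP_append, List.countP_map]
    by_cases hwv : v = w
    · subst hwv
      have hl0 : ¬ v ⊆ l.cluster := fun hsub => by
        obtain ⟨p, hp⟩ := hs.nonempty₂
        exact Finset.disjoint_left.1 hs.disjoint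
          (hsub (hs.union ▸ Finset.mem_union_right _ hp)) hp
      have hr0 : ¬ v ⊆ r.cluster := fun hsub => by
        obtain ⟨p, hp⟩ := hs.nonempty₁
        exact Finset.disjoint_left.1 hs.disjoint hp
          (hsub (hs.union ▸ Finset.mem_union_left _ hp))
      rw [hzero hl htl hl0, hzero hr htr hr0]
      refine (Nat.add_le_add_right List.countP_le_length _).trans ?_
      rw [List.length_drop, length_transformRow, List.length_append]
      omega
    · have h0 : ((transformRow (Φl ++ Φr) Q).drop (polyDim d q)).countP
          ((fun x => decide (x.1 = w)) ∘ fun σ => (v, σ)) = 0 := by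
        rw [List.countP_eq_zero]
        intro σ _
        simpa using hwv
      rw [h0, zero_add]
      rcases w.eq_empty_or_nonempty with hw0 | ⟨p, hp⟩
      · rw [hne hl htl hw0, hne hr htr hw0]
        exact Nat.zero_le _
      · by_cases hpl : p ∈ l.cluster
        · rw [hzero hr htr fun hsub => Finset.disjoint_left.1 hs.disjoint hpl (hsub hp)]
          exact ihl htl
        · rw [hzero hl htl fun hsub => hpl (hsub hp), zero_add]
          exact ihr htr

theorem card_filter_get_eq_countP {α : Type*} (l : List α) (p : α → Prop) [DecidablePred p] :
    (Finset.univ.filter fun a : Fin l.length => p (l.get a)).card = l.countP p := by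
  have h : Multiset.map l.get Finset.univ.val = (l : Multiset α) := by
    rw [Fin.univ_val_map, List.ofFn_get]
  rw [← Multiset.coe_countP, ← h, Multiset.countP_map]
  rfl

theorem IsSampletBasis.length_eq (hB : IsSampletBasis X q t B)
    (ht : t.IsBisection X (polyDim d q)) : B.length = t.cluster.card := by
  obtain ⟨Φ, S, hc, rfl⟩ := hB
  rw [List.length_append, List.length_map, hc.length_add ht]

theorem IsSampletBasis.exists_isClusterAt (hB : IsSampletBasis X q t B) {x}
    (hx : x ∈ B) : ∃ j, t.IsClusterAt j x.1 := by
  obtain ⟨Φ, S, hc, rfl⟩ := hB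
  rw [List.mem_append, List.mem_map] at hx
  rcases hx with ⟨φ, -, rfl⟩ | hx
  · exact ⟨0, t.isClusterAt_cluster⟩
  · exact hc.exists_isClusterAt x hx

theorem IsSampletBasis.card_filter_le (hB : IsSampletBasis X q t B)
    (ht : t.IsBisection X (polyDim d q)) (w : Finset (Fin N)) :
    (Finset.univ.filter fun a : Fin B.length => (B.get a).1 = w).card ≤ 2 * polyDim d q := by
  obtain ⟨Φ, S, hc, rfl⟩ := hB
  refine (card_filter_get_eq_countP _ fun x : Finset (Fin N) × (Fin N → ℝ) => x.1 = w).le.trans ?_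
  rw [List.countP_append, two_mul]
  refine Nat.add_le_add (List.countP_le_length.trans ?_) (hc.countP_le ht w)
  rw [List.length_map]
  exact hc.length_le ht

end Basis

/-! ### Counting inadmissible pairs. -/

section Counting

variable {d N : ℕ} {X : Fin N → EuclideanSpace ℝ (Fin d)} {v w : Finset (Fin N)}

theorem Admissible.symm {η : ℝ} (h : Admissible X η v w) : Admissible X η w v := by
  unfold Admissible setDist at h ⊢
  rw [max_comm, Set.image2_swap]
  simpa only [dist_comm] using h

/-- Some points of the two boxes are closer than `η * ρ`; crossing each box adds at most `ρ`. -/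
theorem dist_le_of_not_admissible {η ρ : ℝ} (hη : 0 < η) (hna : ¬ Admissible X η v w)
    (hv : d * maxEdge X v ≤ ρ) (hw : d * maxEdge X w ≤ ρ) {p p' : Fin N} (hp : p ∈ v)
    (hp' : p' ∈ w) : dist (X p') (X p) ≤ (2 + η) * ρ := by
  unfold Admissible setDist at hna
  rw [not_le] at hna
  obtain ⟨_, ⟨y, hy, z, hz, rfl⟩, hyz⟩ := exists_lt_of_csInf_lt
    (Set.Nonempty.image2 ⟨_, mem_boundingBox hp⟩ ⟨_, mem_boundingBox hp'⟩) hna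
  have h₁ := dist_le_of_mem_boundingBox ⟨p, hp⟩ hy (mem_boundingBox (X := X) hp)
  have h₂ := dist_le_of_mem_boundingBox ⟨p', hp'⟩ (mem_boundingBox (X := X) hp') hz
  have h₃ : max (Metric.diam (boundingBox X v)) (Metric.diam (boundingBox X w)) ≤ ρ :=
    max_le ((diam_boundingBox_le ⟨p, hp⟩).trans hv) ((diam_boundingBox_le ⟨p', hp'⟩).trans hw)
  have h₄ := mul_le_mul_of_nonneg_left h₃ hη.le
  have h₅ := dist_triangle4 (X p') z y (X p)
  rw [dist_comm z y] at h₅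
  linarith

/-- Boundedly many clusters of a given depth are close to a cluster of at least that depth. -/
theorem card_close_clusters_le {m : ℕ} (hd : 0 < d) {s h c T η : ℝ} (hs : 0 < s)
    (hsep : ∀ p p', p ≠ p' → s ≤ dist (X p) (X p')) (hh : 0 < h) (hhs : h ≤ c * s)
    (hη : 0 < η) (hT : 1 ≤ T) {t : ClusterTree N} (ht : IsBisectionTreeFor X m t)
    (hsize : ∀ (j : ℕ) (w : Finset (Fin N)), t.IsClusterAt j w →
      maxEdge X w ^ d ≤ (T * h) ^ d * w.card)
    {i j : ℕ} (hji : j ≤ i) (hv : t.IsClusterAt i v) (W : Finset (Finset (Fin N)))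
    (hW : ∀ w ∈ W, t.IsClusterAt j w ∧ ¬ Admissible X η v w) :
    (W.card : ℝ) ≤ 5 * (2 * ((2 + η) * (d * (T * c))) + 1) ^ d := by
  obtain ⟨x, hx⟩ : ∃ x : ℝ, x = N / 2 ^ j := ⟨_, rfl⟩
  have hx0 : 0 ≤ x := by rw [hx]; positivity
  have hN : t.cluster.card = N := by rw [ht.1, Finset.card_univ, Fintype.card_fin]
  have hupper : ∀ i' w, j ≤ i' → t.IsClusterAt i' w → (w.card : ℝ) ≤ x + 2 := by
    intro i' w hi' hw
    have h₁ := (hw.card_bounds ht.2).1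
    rw [hN] at h₁
    have h₂ : (2 : ℝ) ^ j ≤ 2 ^ i' := pow_le_pow_right₀ (by norm_num) hi'
    have h₃ : (0 : ℝ) < 2 ^ j := by positivity
    rcases le_total ((w.card : ℝ) - 2) 0 with h₄ | h₄
    · linarith
    · have h₅ : (w.card : ℝ) - 2 ≤ x := by
        rw [hx, le_div_iff₀ h₃]
        nlinarith
      linarith
  -- From `x ≤ w.card + 2` and `1 ≤ w.card` follows `x + 2 ≤ 5 * w.card`, which also covers tiny
  -- clusters.
  have hlower : ∀ w, t.IsClusterAt j w → (x + 2) / 5 ≤ w.card := by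
    intro w hw
    have h₁ := (hw.card_bounds ht.2).2
    rw [hN] at h₁
    have h₂ : (1 : ℝ) ≤ w.card := by exact_mod_cast (hw.nonempty ht.2).card_pos
    have h₃ : x ≤ w.card + 2 := by
      rw [hx, div_le_iff₀ (by positivity)]
      linarith
    linarith
  -- Box edges at depth `j` or deeper are at most `T * h * δ`, so packing allows a multiple of `δ ^
  -- d = x + 2` points in all.
  obtain ⟨δ, hδ⟩ : ∃ δ : ℝ, δ = (x + 2) ^ ((d : ℝ)⁻¹) := ⟨_, rfl⟩
  have hδd : δ ^ d = x + 2 := by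
    rw [hδ]
    exact Real.rpow_inv_natCast_pow (by linarith) hd.ne'
  have hδ0 : 0 ≤ δ := by rw [hδ]; positivity
  have hδ1 : 1 ≤ δ := by
    rw [hδ]
    exact Real.one_le_rpow (by linarith) (by positivity)
  have hc0 : 0 ≤ c := by
    by_contra! hc
    nlinarith
  have hedge : ∀ i' w, j ≤ i' → t.IsClusterAt i' w → d * maxEdge X w ≤ d * (T * h * δ) := by
    intro i' w hi' hw
    refine mul_le_mul_of_nonneg_left ?_ d.cast_nonneg
    rw [← pow_le_pow_iff_left₀ (maxEdge_nonneg (hw.nonempty ht.2)) (by positivity) hd.ne',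
      mul_pow _ δ, hδd]
    exact (hsize i' w hw).trans (by gcongr; exact hupper i' w hi' hw)
  obtain ⟨p, hp⟩ := hv.nonempty ht.2
  have hcard := card_le_of_separated (R := (2 + η) * (d * (T * h * δ))) hs (by positivity) hsep
    (X p) (W.biUnion fun w => w) (by
      intro p' hp'
      obtain ⟨w, hw, hpw⟩ := Finset.mem_biUnion.1 hp'
      obtain ⟨hwt, hna⟩ := hW w hw
      exact dist_le_of_not_admissible hη hna (hedge i v hji hv) (hedge j w le_rfl hwt) hp hpw)
  rw [Finset.card_biUnion fun w hw w' hw' hne =>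
    (hW w hw).1.disjoint ht.2 (hW w' hw').1 hne] at hcard
  push_cast at hcard
  have h₁ : W.card * ((x + 2) / 5) ≤ ∑ w ∈ W, (w.card : ℝ) := by
    rw [← nsmul_eq_mul]
    exact Finset.card_nsmul_le_sum _ _ _ fun w hw => hlower w (hW w hw).1
  have h₂ : 2 * ((2 + η) * (d * (T * h * δ))) / s + 1 ≤
      (2 * ((2 + η) * (d * (T * c))) + 1) * δ := by
    have h₃ : h / s ≤ c := by rwa [div_le_iff₀ hs]
    calc 2 * ((2 + η) * (d * (T * h * δ))) / s + 1
        = 2 * ((2 + η) * (d * (T * (h / s)))) * δ + 1 := by field_simp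
      _ ≤ 2 * ((2 + η) * (d * (T * c))) * δ + δ := by gcongr
      _ = _ := by ring
  have h₄ : (2 * ((2 + η) * (d * (T * h * δ))) / s + 1) ^ d ≤
      (2 * ((2 + η) * (d * (T * c))) + 1) ^ d * (x + 2) := by
    rw [← hδd, ← mul_pow]
    gcongr
  have h₅ : W.card * (x + 2) ≤ 5 * (2 * ((2 + η) * (d * (T * c))) + 1) ^ d * (x + 2) := by
    linarith
  exact le_of_mul_le_mul_right h₅ (by linarith)

/-- Every related pair or its swap has the second entry at most as deep as the first, whence the
factor 2. -/
theorem card_symmetric_rel_le {n : ℕ} (r : Fin n → Fin n → Prop) [DecidableRel r]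
    (hr : ∀ a b, r a b → r b a) (dep : Fin n → ℕ) (K : ℝ)
    (hK : ∀ a, ((Finset.univ.filter fun b => r a b ∧ dep b ≤ dep a).card : ℝ) ≤ K) :
    ((Finset.univ.filter fun e : Fin n × Fin n => r e.1 e.2).card : ℝ) ≤ 2 * (n * K) := by
  set P := Finset.univ.filter fun e : Fin n × Fin n => r e.1 e.2 ∧ dep e.2 ≤ dep e.1 with hP
  have hsub : (Finset.univ.filter fun e : Fin n × Fin n => r e.1 e.2) ⊆
      P ∪ P.image Prod.swap := by
    intro e he
    rw [Finset.mem_filter] at he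
    rw [Finset.mem_union]
    rcases le_total (dep e.2) (dep e.1) with hle | hle
    · exact Or.inl (Finset.mem_filter.2 ⟨Finset.mem_univ _, he.2, hle⟩)
    · exact Or.inr (Finset.mem_image.2
        ⟨e.swap, Finset.mem_filter.2 ⟨Finset.mem_univ _, hr _ _ he.2, hle⟩, e.swap_swap⟩)
  have hPc : (P.card : ℝ) ≤ n * K := by
    rw [Finset.card_eq_sum_card_fiberwise (f := Prod.fst) (t := Finset.univ)
      fun _ _ => Finset.mem_coe.2 (Finset.mem_univ _)]
    push_cast
    refine (Finset.sum_le_card_nsmul _ _ K fun a _ => (Nat.cast_le.2 ?_).trans (hK a)).trans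
      (by simp)
    refine Finset.card_le_card_of_injOn Prod.snd ?_ ?_
    · intro e he
      simp only [hP, Finset.coe_filter, Finset.mem_filter, Finset.mem_univ, true_and,
        Set.mem_ofPred_eq] at he ⊢
      rw [← he.2]
      exact he.1
    · intro e he e' he' hee
      simp only [Finset.coe_filter, Set.mem_ofPred_eq] at he he'
      exact Prod.ext (he.2.trans he'.2.symm) hee
  have h₁ := (Finset.card_le_card hsub).trans (Finset.card_union_le _ _)
  have h₂ := Finset.card_image_le (s := P) (f := Prod.swap)
  have h₃ : ((Finset.univ.filter fun e : Fin n × Fin n => r e.1 e.2).card : ℝ) ≤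
      P.card + P.card := by
    exact_mod_cast h₁.trans (Nat.add_le_add_left h₂ _)
  linarith

end Counting

/-! ### Consequences of quasi-uniformity, and the final count. -/

section QuasiUniform

variable {d : ℕ} {Ω : Set (EuclideanSpace ℝ (Fin d))} {c : ℝ≥0}
  {X : (N : ℕ) → Fin N → EuclideanSpace ℝ (Fin d)}

theorem IsQuasiUniform.exists_separation (hX : IsQuasiUniform Ω c X) {N : ℕ} (hN : 2 ≤ N) :
    ∃ s : ℝ, 0 < s ∧ (∀ p p', p ≠ p' → s ≤ dist (X N p) (X N p')) ∧
      ∀ y ∈ Ω, ∃ p, dist y (X N p) ≤ c * s := by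
  have hne : (Finset.univ.filter fun e : Fin N × Fin N => e.1 ≠ e.2).Nonempty :=
    ⟨(⟨0, by omega⟩, ⟨1, by omega⟩), by simp⟩
  obtain ⟨e, he, hmin⟩ := Finset.exists_min_image _
    (fun e : Fin N × Fin N => dist (X N e.1) (X N e.2)) hne
  rw [Finset.mem_filter] at he
  refine ⟨dist (X N e.1) (X N e.2), dist_pos.2 fun h => he.2 (hX.injective N h),
    fun p p' hpp => hmin (p, p') (by simpa using hpp), fun y hy => ?_⟩
  have : Nonempty (Fin N) := ⟨e.1⟩
  obtain ⟨p, hp⟩ := exists_eq_ciInf_of_finite (f := fun i => edist y (X N i))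
  refine ⟨p, ?_⟩
  have h₁ : edist y (X N p) ≤ fillDistance Ω (X N) := by
    rw [hp]
    exact le_iSup₂ (f := fun x (_ : x ∈ Ω) => ⨅ i : Fin N, edist x (X N i)) y hy
  have h₂ : sepRadius (X N) ≤ edist (X N e.1) (X N e.2) := by
    refine ENNReal.half_le_self.trans ?_
    exact iInf_le_of_le e.1 (iInf_le_of_le e.2 (iInf_le _ he.2))
  have h₃ : edist y (X N p) ≤ c * edist (X N e.1) (X N e.2) :=
    h₁.trans ((hX.fill_le N hN).trans (by gcongr))
  rw [edist_dist, edist_dist, ← ENNReal.ofReal_coe_nnreal,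
    ← ENNReal.ofReal_mul c.coe_nonneg, ENNReal.ofReal_le_ofReal_iff (by positivity)] at h₃
  exact h₃

/-- The two-point set `X 2` already has finite fill distance, so `Ω` is bounded; it is open and
contains `X 2 0`. -/
theorem IsQuasiUniform.exists_balls (hX : IsQuasiUniform Ω c X) (hΩ : IsOpen Ω) :
    ∃ (x₀ : EuclideanSpace ℝ (Fin d)) (r R : ℝ), 0 < r ∧ r ≤ R ∧ Metric.ball x₀ r ⊆ Ω ∧
      Ω ⊆ Metric.closedBall x₀ R := by
  obtain ⟨r, hr, hball⟩ := Metric.isOpen_iff.1 hΩ _ (hX.mem 2 0)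
  obtain ⟨s, -, -, hfill⟩ := hX.exists_separation (le_refl 2)
  refine ⟨X 2 0, r, max r (c * s + dist (X 2 1) (X 2 0)), hr, le_max_left _ _, hball,
    fun y hy => Metric.mem_closedBall.2 ((le_max_right _ _).trans' ?_)⟩
  obtain ⟨p, hp⟩ := hfill y hy
  have hp' : dist (X 2 p) (X 2 0) ≤ dist (X 2 1) (X 2 0) := by
    fin_cases p <;> simp
  linarith [dist_triangle y (X 2 p) (X 2 0)]

end QuasiUniform

theorem add_one_mul_log_two_le {j N : ℕ} (hN : 2 ≤ N) (h : 2 ^ j ≤ N ^ 3) :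
    (j + 1 : ℝ) ≤ 4 / Real.log 2 * Real.log N := by
  have h2 : 0 < Real.log 2 := Real.log_pos (by norm_num)
  have h₁ : (j : ℝ) * Real.log 2 ≤ 3 * Real.log N := by
    have h₃ : ((2 : ℝ)) ^ j ≤ (N : ℝ) ^ 3 := by exact_mod_cast h
    have := Real.log_le_log (by positivity) h₃
    rwa [Real.log_pow, Real.log_pow] at this
  have h₂ : Real.log 2 ≤ Real.log N := Real.log_le_log (by norm_num) (by exact_mod_cast hN)
  rw [div_mul_eq_mul_div, le_div_iff₀ h2]
  linarith

/-- The number of non-admissible pairs of elements of a samplet basis. -/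
theorem IsSampletBasis.card_not_admissible_le {d N q : ℕ} (hd : 0 < d)
    {X : Fin N → EuclideanSpace ℝ (Fin d)} {s h c T η : ℝ} (hs : 0 < s)
    (hsep : ∀ p p', p ≠ p' → s ≤ dist (X p) (X p')) (hh : 0 < h) (hhs : h ≤ c * s)
    (hη : 0 < η) (hT : 1 ≤ T) (hN : 2 ≤ N) {t : ClusterTree N}
    (ht : IsBisectionTreeFor X (polyDim d q) t)
    (hsize : ∀ (j : ℕ) (w : Finset (Fin N)), t.IsClusterAt j w →
      maxEdge X w ^ d ≤ (T * h) ^ d * w.card)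
    {B : List (Finset (Fin N) × (Fin N → ℝ))} (hB : IsSampletBasis X q t B) :
    (Set.ncard {e : Fin B.length × Fin B.length |
        ¬ Admissible X η (B.get e.1).1 (B.get e.2).1} : ℝ) ≤
      2 * (4 / Real.log 2 * (2 * polyDim d q *
        (5 * (2 * ((2 + η) * (d * (T * c))) + 1) ^ d))) * (N * Real.log N) := by
  classical
  have hcard : t.cluster.card = N := by rw [ht.1, Finset.card_univ, Fintype.card_fin]
  have hlen : B.length = N := (hB.length_eq ht.2).trans hcard
  choose dep hdep using fun a : Fin B.length => hB.exists_isClusterAt (B.get_mem a)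
  set G : ℝ := 5 * (2 * ((2 + η) * (d * (T * c))) + 1) ^ d with hG
  have hG0 : 0 ≤ G := by
    have hc0 : 0 ≤ c := by
      by_contra! hc
      nlinarith
    rw [hG]
    positivity
  have hrow : ∀ a, ((Finset.univ.filter fun b => ¬ Admissible X η (B.get a).1 (B.get b).1 ∧
      dep b ≤ dep a).card : ℝ) ≤ 4 / Real.log 2 * (2 * polyDim d q * G) * Real.log N := by
    intro a
    -- One depth contributes boundedly many clusters, each with at most `2 * polyDim d q` elements;
    -- the number of depths gives the logarithm.
    have hfib : ∀ j ∈ Finset.range (dep a + 1),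
        ((((Finset.univ.filter fun b => ¬ Admissible X η (B.get a).1 (B.get b).1 ∧
          dep b ≤ dep a).filter fun b => dep b = j).card : ℕ) : ℝ) ≤ 2 * polyDim d q * G := by
      intro j hj
      rw [Finset.mem_range] at hj
      have h₁ := card_close_clusters_le hd hs hsep hh hhs hη hT ht hsize (i := dep a) (j := j)
        (by omega) (hdep a)
        (Finset.univ.filter fun w => t.IsClusterAt j w ∧ ¬ Admissible X η (B.get a).1 w)
        (fun w hw => (Finset.mem_filter.1 hw).2)
      have h₂ := Finset.card_le_mul_card_image_of_maps_to
        (s := (Finset.univ.filter fun b => ¬ Admissible X η (B.get a).1 (B.get b).1 ∧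
          dep b ≤ dep a).filter fun b => dep b = j)
        (t := Finset.univ.filter fun w => t.IsClusterAt j w ∧ ¬ Admissible X η (B.get a).1 w)
        (f := fun b => (B.get b).1) (fun b hb => by
          rw [Finset.mem_filter, Finset.mem_filter] at hb
          exact Finset.mem_filter.2 ⟨Finset.mem_univ _, hb.2 ▸ hdep b, hb.1.2.1⟩)
        (2 * polyDim d q) (fun w _ => (Finset.card_le_card
          (Finset.filter_subset_filter _ (Finset.subset_univ _))).trans
            (hB.card_filter_le ht.2 w))
      calc _ ≤ ((2 * polyDim d q * (Finset.univ.filter fun w =>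
            t.IsClusterAt j w ∧ ¬ Admissible X η (B.get a).1 w).card : ℕ) : ℝ) :=
            Nat.cast_le.2 h₂
        _ ≤ _ := by
            push_cast
            gcongr
    rw [Finset.card_eq_sum_card_fiberwise (f := dep) (t := Finset.range (dep a + 1))
      fun b hb => by
        have := (Finset.mem_filter.1 (Finset.mem_coe.1 hb)).2.2
        exact Finset.mem_coe.2 (Finset.mem_range.2 (by omega))]
    push_cast
    refine (Finset.sum_le_card_nsmul _ _ _ hfib).trans ?_
    rw [Finset.card_range, nsmul_eq_mul]
    have h₁ := add_one_mul_log_two_le hN (hcard ▸ (hdep a).two_pow_le ht.2)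
    calc ((dep a + 1 : ℕ) : ℝ) * (2 * polyDim d q * G)
        ≤ 4 / Real.log 2 * Real.log N * (2 * polyDim d q * G) := by
          push_cast
          gcongr
      _ = _ := by ring
  have hfin := card_symmetric_rel_le
    (fun a b => ¬ Admissible X η (B.get a).1 (B.get b).1) (fun a b hab hba => hab hba.symm) dep _
    hrow
  rw [Set.ncard_eq_toFinset_card', Set.toFinset_ofPred]
  refine hfin.trans (le_of_eq ?_)
  rw [hlen]
  ring

theorem proposition4p3p8 (d : ℕ) (hd : 0 < d) (Ω : Set (EuclideanSpace ℝ (Fin d)))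
    (hΩ_open : IsOpen Ω) (hΩ_convex : Convex ℝ Ω) (q : ℕ) (η : ℝ) (hη : 0 < η) (c : NNReal) :
    ∃ C : ℝ, ∀ X : (N : ℕ) → Fin N → EuclideanSpace ℝ (Fin d), IsQuasiUniform Ω c X →
      ∀ (k : EuclideanSpace ℝ (Fin d) → EuclideanSpace ℝ (Fin d) → ℝ) (N : ℕ), 2 ≤ N →
      ∀ t : ClusterTree N, IsBisectionTreeFor (X N) (polyDim d q) t →
      ∀ B : List (Finset (Fin N) × (Fin N → ℝ)), IsSampletBasis (X N) q t B →
        (Set.ncard {e : Fin B.length × Fin B.length |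
            ¬ Admissible (X N) η (B.get e.1).1 (B.get e.2).1} : ℝ) ≤ C * (N * Real.log N) ∧
        (Set.ncard {e : Fin B.length × Fin B.length |
            compressedMatrix (X N) k η B e.1 e.2 ≠ 0} : ℝ) ≤ C * (N * Real.log N) := by
  by_cases hballs : ∃ (x₀ : EuclideanSpace ℝ (Fin d)) (r R : ℝ), 0 < r ∧ r ≤ R ∧
      Metric.ball x₀ r ⊆ Ω ∧ Ω ⊆ Metric.closedBall x₀ R
  swap
  -- An empty or unbounded `Ω` admits no quasi-uniform sequence.
  · exact ⟨0, fun X hX => (hballs (hX.exists_balls hΩ_open)).elim⟩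
  obtain ⟨x₀, r, R, hr, hrR, hball, hR⟩ := hballs
  -- Enlarging `c` makes `h = c' * s` positive. The value of `D` below is the packing bound for
  -- radius `4 * h`.
  obtain ⟨c', hc', hc1⟩ : ∃ c' : ℝ, c ≤ c' ∧ 1 ≤ c' := ⟨max c 1, le_max_left _ _, le_max_right _ _⟩
  obtain ⟨T, hT1, hT⟩ := exists_maxEdge_pow_le hd ⌈(8 * c' + 1) ^ d⌉₊ hr hrR hball hR
  refine ⟨2 * (4 / Real.log 2 * (2 * polyDim d q *
    (5 * (2 * ((2 + η) * (d * (T * c'))) + 1) ^ d))), fun X hX k N hN t ht B hB => ?_⟩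
  obtain ⟨s, hs, hsep, hfill⟩ := hX.exists_separation hN
  have hnet : IsNet Ω (X N) (c' * s) ⌈(8 * c' + 1) ^ d⌉₊ := by
    refine ⟨hΩ_convex, hX.mem N, by positivity, fun y hy => ?_, fun y F hF => ?_⟩
    · obtain ⟨p, hp⟩ := hfill y hy
      exact ⟨p, hp.trans (by gcongr)⟩
    · have h₁ := card_le_of_separated hs (by positivity) hsep y F hF
      have e : 2 * (4 * (c' * s)) / s + 1 = 8 * c' + 1 := by
        field_simp
        ring
      rw [e] at h₁
      exact_mod_cast h₁.trans (Nat.le_ceil _)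
  have hmain := hB.card_not_admissible_le hd hs hsep (mul_pos (by positivity) hs) le_rfl hη hT1 hN
    ht (hT N _ (X N) _ hnet t ht)
  refine ⟨hmain, le_trans (Nat.cast_le.2 (Set.ncard_le_ncard ?_ (Set.toFinite _))) hmain⟩
  intro e he hadm
  exact he (if_pos hadm)
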